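/- **Conventions.** A dominant meromorphic self-map $f$ of $\mathbb P^k$ is written $f=[G_0:\dots:G_k]$ with homogeneous polynomials $G_i$ of the same degree without nontrivial common factor; $F=(G_0,\dots,G_k)$ is a *lifting* of $f$, and $\mathcal I(f)=\{G_0=\dots=G_k=0\}$ is the indeterminacy locus. $f^n$ is the $n$-th iterate as a meromorphic map (its lifting is obtained from $F\circ\dots\circ F$ by removing common factors), and for a hypersurface $\mathcal H$, $f^n(\mathcal H)$ is the closure of $f^n(\mathcal H\setminus\mathcal I(f^n))$. A hypersurface $\mathcal H$ is *degree lowering of height $n$* if $n\ge 1$ is the smallest integer with $f^n(\mathcal H)\subset\mathcal I(f)$. A *primitive system* of $f$ is a finite collection of degree lowering hypersurfaces $\mathcal H_1,\dots,\mathcal H_M$ of pairwise different heights $n_1,\dots,n_M$ such that $\operatorname{codim} f^m(\mathcal H_j)>1$ for $1\le m\le n_j$, and such that for each irreducible degree lowering hypersurface $\mathcal H$, of height $n$ say, there are $0\le m<n$ and $j$ for which $f^m(\mathcal H)$ is a hypersurface contained in $\mathcal H_j$. The map $f$ is *quasi-algebraically stable* (QAS) if there are an integer $n_0\ge1$ and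 a homogeneous polynomial $H\neq0$ such that, for arbitrarily fixed liftings $F_0,\dots,F_{n_0}$ of $f^0=\mathrm{Id},\dots,f^{n_0}$, the recursion $F_n:=\dfrac{F_1\circ F_{n-1}}{H\circ F_{n-n_0-1}}$, $n>n_0$, defines liftings $F_n$ of $f^n$ for all $n$. **Statement.** Let $P,Q_1,Q_2,Q_3,R\in\mathbb C[z,w,t]$ be homogeneous, $\deg P\ge1$, $\deg Q_1=\deg Q_2=\deg Q_3$, $\deg R=\deg P+\deg Q_1$, with $$P(1,1,1)\,Q_j(1,1,1)=R(1,1,1)\ne0,\qquad j=1,2,3,$$ and suppose that $PQ_1-R,\ PQ_2-R,\ PQ_3-R$ have no nontrivial common factor. Put $f:=[PQ_1-R:PQ_2-R:PQ_3-R]$. Assume: 1. for all $(a,b,c)\in\mathbb C^3\setminus\{0\}$ with $a+b+c=0$, every irreducible component of $\{aQ_1+bQ_2+cQ_3=0\}$ is mapped by $f$ onto a curve (if $aQ_1+bQ_2+cQ_3\equiv 0$, this is required of every irreducible curve); 2. every irreducible component of $\{P=0\}$ is mapped by $f^2$ onto a curve; 3. every irreducible curve $\mathcal G$ with $f(\mathcal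 G)=[1:1:1]$ is contained in $\{P=0\}$. Then $f$ is a dominant meromorphic self-map of $\mathbb P^2$, and with $\mathcal H_0:=\{P=0\}$ and $n_0:=1$: (i) $f$ has exactly one primitive system, and it consists of the single hypersurface $\mathcal H_0$, of height $n_0$; (ii) for every irreducible component $\mathcal H$ of $\mathcal H_0$ and every $m=1,\dots,n_0$, $f^m(\mathcal H)\not\subset\mathcal H_0$; (iii) for every irreducible component $\mathcal H$ of $\mathcal H_0$, either $f^m(\mathcal H)\not\subset\mathcal I(f)$ for all $m\ge n_0+1$, or there is $m_0\ge n_0$ such that $f^{m_0+1}(\mathcal H)$ is a hypersurface and $f^m(\mathcal H)\not\subset\mathcal I(f)$ whenever $n_0+1\le m\le m_0$. Moreover, $f$ is QAS. -/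

import Mathlib

open MvPolynomial

namespace QASMap

/-- Complex projective space `ℙ^k`. -/
abbrev PSpace (k : ℕ) : Type := Projectivization ℂ (Fin (k + 1) → ℂ)

/-- Polynomials in the `k + 1` homogeneous coordinates of `ℙ^k`. -/
abbrev Poly (k : ℕ) : Type := MvPolynomial (Fin (k + 1)) ℂ

/-- A `(k + 1)`-tuple of polynomials, that is, a polynomial self-map of `ℂ^{k+1}`. -/
abbrev PolyMap (k : ℕ) : Type := Fin (k + 1) → Poly k

/-! ### Hypersurfaces -/

/-- The zero locus `{G = 0}` in `ℙ^k` of a polynomial `G`; it is only used for homogeneous `G`,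
where the choice of the representative is irrelevant (see `mk_mem_zeroLocus`). -/
def zeroLocus {k : ℕ} (G : Poly k) : Set (PSpace k) :=
  {p | eval p.rep G = 0}

theorem mk_mem_zeroLocus {k : ℕ} {G : Poly k} {e : ℕ} (hG : G.IsHomogeneous e)
    (v : Fin (k + 1) → ℂ) (hv : v ≠ 0) :
    Projectivization.mk ℂ v hv ∈ zeroLocus G ↔ eval v G = 0 := by
  obtain ⟨a, ha⟩ := Projectivization.exists_smul_eq_mk_rep ℂ v hv
  have h : eval ((a : ℂ) • v) G = (a : ℂ) ^ e * eval v G := by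
    rw [eval_eq, eval_eq, Finset.mul_sum]
    refine Finset.sum_congr rfl fun d hd => ?_
    have hd' : ∑ i ∈ d.support, d i = e := by
      have := hG (mem_support_iff.mp hd)
      simpa [Finsupp.weight_apply, Finsupp.sum] using this
    simp only [Pi.smul_apply, smul_eq_mul, mul_pow, Finset.prod_mul_distrib,
      Finset.prod_pow_eq_pow_sum, hd']
    ring
  have h2 : (Projectivization.mk ℂ v hv).rep = (a : ℂ) • v := ha.symm
  change eval (Projectivization.mk ℂ v hv).rep G = 0 ↔ _
  rw [h2, h]
  simp

/-- A (possibly reducible) hypersurface of `ℙ^k`, as a set. -/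
def IsHypersurface {k : ℕ} (V : Set (PSpace k)) : Prop :=
  ∃ (G : Poly k) (e : ℕ), 0 < e ∧ G.IsHomogeneous e ∧ G ≠ 0 ∧ V = zeroLocus G

/-- An irreducible hypersurface of `ℙ^k`. The irreducible components of a hypersurface `V` are
exactly the irreducible hypersurfaces contained in `V`. -/
def IsIrreducibleHypersurface {k : ℕ} (V : Set (PSpace k)) : Prop :=
  ∃ (G : Poly k) (e : ℕ), G.IsHomogeneous e ∧ Irreducible G ∧ V = zeroLocus G

/-- An algebraic subset of `ℙ^k` has codimension `> 1` iff it contains no irreducible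
hypersurface. -/
def CodimGtOne {k : ℕ} (V : Set (PSpace k)) : Prop :=
  ∀ W : Set (PSpace k), IsIrreducibleHypersurface W → ¬ W ⊆ V

/-- Zariski closure in `ℙ^k`. -/
def zariskiClosure {k : ℕ} (S : Set (PSpace k)) : Set (PSpace k) :=
  {p | ∀ (G : Poly k) (e : ℕ), G.IsHomogeneous e → S ⊆ zeroLocus G → p ∈ zeroLocus G}

/-! ### Meromorphic self-maps, images and iterates -/

/-- The components of `F` have no nontrivial common factor. -/
def NoCommonFactor {k : ℕ} (F : PolyMap k) : Prop :=
  ∀ A : Poly k, (∀ i, A ∣ F i) → IsUnit A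

/-- The value `F(x) ∈ ℂ^{k+1}`. -/
noncomputable def evalMap {k : ℕ} (F : PolyMap k) (x : Fin (k + 1) → ℂ) : Fin (k + 1) → ℂ :=
  fun i => eval x (F i)

/-- The indeterminacy locus of the self-map with lifting `F`: the common zeros of the
components. -/
def indeterminacy {k : ℕ} (F : PolyMap k) : Set (PSpace k) :=
  {p | evalMap F p.rep = 0}

/-- For the self-map `f` with lifting `F`: the set `f(V)`, i.e. the closure of
`f(V \ I(f))`. (The image is constructible for algebraic `V`, so that the Zariski closure is also
the closure in the usual topology.) -/
def image {k : ℕ} (F : PolyMap k) (V : Set (PSpace k)) : Set (PSpace k) :=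
  zariskiClosure
    {p | ∃ q ∈ V, ∃ h : evalMap F q.rep ≠ 0, p = Projectivization.mk ℂ (evalMap F q.rep) h}

/-- `F` is a lifting of a dominant meromorphic self-map of `ℙ^k`: its components are homogeneous
of one and the same degree, have no nontrivial common factor, and the image is dense. -/
structure IsDominantSelfMap {k : ℕ} (F : PolyMap k) : Prop where
  homogeneous : ∃ d : ℕ, ∀ i, (F i).IsHomogeneous d
  noCommonFactor : NoCommonFactor F
  dominant : image F Set.univ = Set.univ

/-- Composition `G ∘ F` of a polynomial with a polynomial map. -/
noncomputable def comp {k : ℕ} (G : Poly k) (F : PolyMap k) : Poly k :=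
  bind₁ F G

/-- The `n`-fold composition `F ∘ ⋯ ∘ F` as polynomial maps, common factors not removed. -/
noncomputable def polyIterate {k : ℕ} (F : PolyMap k) : ℕ → PolyMap k
  | 0 => X
  | n + 1 => fun i => comp (F i) (polyIterate F n)

/-- `G` is a lifting of the `n`-th iterate `f^n` of the self-map `f` with lifting `F`: it arises
from `F ∘ ⋯ ∘ F` by removing a common factor, and has no nontrivial common factor left. Such a `G`
is unique up to a nonzero constant. -/
def IsIterateLifting {k : ℕ} (F : PolyMap k) (n : ℕ) (G : PolyMap k) : Prop :=
  NoCommonFactor G ∧ ∃ c : Poly k, c ≠ 0 ∧ ∀ i, polyIterate F n i = c * G i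

/-- The set `f^n(V)`, where `f^n` is the `n`-th iterate of `f` as a meromorphic self-map. -/
def iterImage {k : ℕ} (F : PolyMap k) (n : ℕ) (V : Set (PSpace k)) : Set (PSpace k) :=
  {p | ∃ G : PolyMap k, IsIterateLifting F n G ∧ p ∈ image G V}

/-! ### Quasi-algebraic stability -/

/-- The self-map `f` with lifting `F` is quasi-algebraically stable: there are `n₀ ≥ 1` and a
homogeneous polynomial `H` such that, for arbitrarily fixed liftings `Φ₀, …, Φ_{n₀}` of
`f^0, …, f^{n₀}`, the recursion `Φ_n = (Φ₁ ∘ Φ_{n-1}) / (H ∘ Φ_{n-n₀-1})`, `n > n₀`, defines a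
sequence of liftings of the iterates `f^n`. -/
def IsQAS {k : ℕ} (F : PolyMap k) : Prop :=
  ∃ (n₀ : ℕ) (H : Poly k) (h : ℕ), 1 ≤ n₀ ∧ H ≠ 0 ∧ H.IsHomogeneous h ∧
    ∀ Φ₀ : ℕ → PolyMap k, (∀ n ≤ n₀, IsIterateLifting F n (Φ₀ n)) →
      ∃ Φ : ℕ → PolyMap k, (∀ n ≤ n₀, Φ n = Φ₀ n) ∧
        (∀ n, IsIterateLifting F n (Φ n)) ∧
        ∀ n, n₀ < n → ∀ i, Φ n i * comp H (Φ (n - n₀ - 1)) = comp (Φ 1 i) (Φ (n - 1))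

/-! ### Degree lowering hypersurfaces and the criterion -/

/-- `V` is a degree lowering hypersurface of `f` with height `n`: `n` is the smallest integer
`≥ 1` with `f^n(V) ⊆ I(f)`. -/
def IsDegreeLowering {k : ℕ} (F : PolyMap k) (V : Set (PSpace k)) (n : ℕ) : Prop :=
  IsHypersurface V ∧ 1 ≤ n ∧ iterImage F n V ⊆ indeterminacy F ∧
    ∀ m, 1 ≤ m → m < n → ¬ iterImage F m V ⊆ indeterminacy F

/-- `S = {(H₁, n₁), …, (H_M, n_M)}` is a system of primitive degree lowering hypersurfaces of `f`
together with their heights. In `captures`, `f^m(V)` is taken before the height `n` of `V` is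
reached, i.e. while it is still the successive image of `V` under `f`. -/
structure IsPrimitiveSystem {k : ℕ} (F : PolyMap k) (S : Set (Set (PSpace k) × ℕ)) : Prop where
  finite : S.Finite
  degreeLowering : ∀ s ∈ S, IsDegreeLowering F s.1 s.2
  heights_ne : ∀ s ∈ S, ∀ t ∈ S, s ≠ t → s.2 ≠ t.2
  codim : ∀ s ∈ S, ∀ m, 1 ≤ m → m ≤ s.2 → CodimGtOne (iterImage F m s.1)
  captures : ∀ (V : Set (PSpace k)) (n : ℕ), IsIrreducibleHypersurface V →
    IsDegreeLowering F V n →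
      ∃ m < n, ∃ s ∈ S, IsHypersurface (iterImage F m V) ∧ iterImage F m V ⊆ s.1

/-- Conditions (i)–(iii) of the criterion for quasi-algebraic stability, where `H₀` is the unique
primitive degree lowering hypersurface and `n₀` is its height. -/
structure SatisfiesCriterion {k : ℕ} (F : PolyMap k) (H₀ : Set (PSpace k)) (n₀ : ℕ) : Prop where
  /-- (i) There is exactly one primitive degree lowering hypersurface: `H₀`, of height `n₀`. -/
  unique_primitive : ∀ S : Set (Set (PSpace k) × ℕ), IsPrimitiveSystem F S ↔ S = {(H₀, n₀)}
  /-- (ii) -/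
  not_subset : ∀ V, IsIrreducibleHypersurface V → V ⊆ H₀ →
    ∀ m, 1 ≤ m → m ≤ n₀ → ¬ iterImage F m V ⊆ H₀
  /-- (iii) -/
  after_height : ∀ V, IsIrreducibleHypersurface V → V ⊆ H₀ →
    (∀ m, n₀ + 1 ≤ m → ¬ iterImage F m V ⊆ indeterminacy F) ∨
    ∃ m₀, n₀ ≤ m₀ ∧ IsHypersurface (iterImage F (m₀ + 1) V) ∧
      ∀ m, n₀ + 1 ≤ m → m ≤ m₀ → ¬ iterImage F m V ⊆ indeterminacy F

/-! ### The family -/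

/-- The polynomial map `(P Q₁ - R, P Q₂ - R, P Q₃ - R)`. -/
noncomputable def familyMap (P R : Poly 2) (Q : Fin 3 → Poly 2) : PolyMap 2 :=
  fun j => P * Q j - R

/-- The point `[1 : 1 : 1]` of `ℙ²`. -/
noncomputable def onePoint : PSpace 2 :=
  Projectivization.mk ℂ (fun _ => 1) (fun h => one_ne_zero (congrFun h 0))

end QASMap

/-!
A line through `[1 : 1 : 1]` pulls back under `f` to `{P = 0}` together with a curve
`{∑ a_j Q_j = 0}`, `∑ a_j = 0`. Hence the components of `{P = 0}` are contracted to `[1 : 1 : 1]`,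
which is a point of indeterminacy outside `{P = 0}`, while every other curve is sent onto a curve,
and so is every component of `{P = 0}` by `f²`. In particular the common factor `H` of `F ∘ F` is
supported on `{P = 0}`.

Write `F ∘ F = H F₂`, let `d` be the degree of `F`, and let `Φ` and `Ψ` be liftings of `f^n` and
`f^(n+1)`, so that `F ∘ Φ = c Ψ` and `c^d (F ∘ Ψ) = F ∘ F ∘ Φ = (H ∘ Φ) (F₂ ∘ Φ)`. The irreducible
factors of `c` are contracted by `f^n` to `[1 : 1 : 1]`, where `H` does not vanish; so `c` and
`H ∘ Φ` are coprime, and `H ∘ Φ` divides `F ∘ Ψ`. The quotient has no common factor left, because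
every curve either is sent onto a curve by `f^(n+1)`, whose image is not contained in `I(f)`, or is
contracted by `f^(n+1)` to `[1 : 1 : 1]` and is sent onto a curve by `F₂ ∘ Φ`.
-/

namespace QASMap

section Homogeneous

variable {σ τ R : Type*} [CommRing R] {G : MvPolynomial σ R} {n : ℕ}

theorem aeval_mul_of_isHomogeneous {S : Type*} [CommRing S] [Algebra R S]
    (hG : G.IsHomogeneous n) (s : S) (y : σ → S) :
    aeval (fun i => s * y i) G = s ^ n * aeval y G := by
  simp only [aeval_def, eval₂_eq, Finset.mul_sum]
  refine Finset.sum_congr rfl fun d hd => ?_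
  rw [Finset.prod_congr rfl fun i _ => mul_pow s (y i) (d i), Finset.prod_mul_distrib,
    Finset.prod_pow_eq_pow_sum, ← hG.degree_eq_sum_deg_support hd]
  ring

theorem bind₁_mul_of_isHomogeneous (hG : G.IsHomogeneous n) (c : MvPolynomial τ R)
    (X : σ → MvPolynomial τ R) : bind₁ (fun i => c * X i) G = c ^ n * bind₁ X G :=
  aeval_mul_of_isHomogeneous hG c X

theorem eval_bind₁ (x : τ → R) (X : σ → MvPolynomial τ R) (G : MvPolynomial σ R) :
    eval x (bind₁ X G) = eval (fun i => eval x (X i)) G := by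
  simp only [← coe_aeval_eq_eval, RingHom.coe_coe, aeval_bind₁]

theorem coeff_aeval_X_mul_C (G : MvPolynomial σ R) (n : ℕ) :
    (aeval (fun i => (Polynomial.X * Polynomial.C (X i) : Polynomial (MvPolynomial σ R))) G).coeff
      n = homogeneousComponent n G := by
  have haeval (H : MvPolynomial σ R) :
      aeval (fun i => Polynomial.C (X i : MvPolynomial σ R)) H = Polynomial.C H := by
    simpa only [aeval_X_left_apply] using!
      aeval_algebraMap_apply (Polynomial _) (X : σ → MvPolynomial σ R) H
  conv_lhs => rw [← sum_homogeneousComponent G, map_sum, Polynomial.finsetSum_coeff]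
  simp only [aeval_mul_of_isHomogeneous (homogeneousComponent_isHomogeneous _ G), haeval,
    Polynomial.X_pow_mul_C, Polynomial.coeff_C_mul_X_pow, Finset.sum_ite_eq, Finset.mem_range]
  exact ite_eq_left_iff.mpr fun h => (homogeneousComponent_eq_zero _ _ (by lia)).symm

theorem isHomogeneous_of_homogeneousComponent_eq_zero {a : ℕ}
    (h : ∀ m, m ≠ a → homogeneousComponent m G = 0) : G.IsHomogeneous a := by
  rw [← sum_homogeneousComponent G]
  refine .sum _ _ _ fun m _ => ?_
  obtain rfl | hm := eq_or_ne m a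
  · exact homogeneousComponent_isHomogeneous m G
  · exact h m hm ▸ isHomogeneous_zero _ _ a

variable [IsDomain R]

/-- The substitution `Xᵢ ↦ T Xᵢ` turns the grading into the degree in `T`, where a factor of a
monomial is a monomial. -/
theorem isHomogeneous_of_mul {A B : MvPolynomial σ R} (h : (A * B).IsHomogeneous n)
    (h0 : A * B ≠ 0) : ∃ a, A.IsHomogeneous a := by
  let scale : MvPolynomial σ R →ₐ[R] Polynomial (MvPolynomial σ R) :=
    aeval fun i => Polynomial.X * Polynomial.C (X i)
  have hcoeff (G m) : (scale G).coeff m = homogeneousComponent m G := coeff_aeval_X_mul_C G m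
  have hmul : scale A * scale B = Polynomial.monomial n (A * B) := by
    ext1 m
    rw [← map_mul, hcoeff, homogeneousComponent_of_mem h, Polynomial.coeff_monomial]
    simp only [eq_comm]
  have hne : scale A * scale B ≠ 0 := by rwa [hmul, Ne, Polynomial.monomial_eq_zero_iff]
  have hA := left_ne_zero_of_mul hne
  have hB := right_ne_zero_of_mul hne
  have htop := congrArg Polynomial.natDegree hmul
  have hbot := congrArg Polynomial.natTrailingDegree hmul
  rw [Polynomial.natDegree_mul hA hB, Polynomial.natDegree_monomial_eq _ h0] at htop
  rw [Polynomial.natTrailingDegree_mul hA hB, Polynomial.natTrailingDegree_monomial h0] at hbot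
  have hleA := Polynomial.natTrailingDegree_le_natDegree (scale A)
  have hleB := Polynomial.natTrailingDegree_le_natDegree (scale B)
  refine ⟨(scale A).natDegree, isHomogeneous_of_homogeneousComponent_eq_zero fun m hm => ?_⟩
  rw [← hcoeff]
  rcases lt_or_gt_of_ne hm with hm | hm
  · exact Polynomial.coeff_eq_zero_of_lt_natTrailingDegree (by lia)
  · exact Polynomial.coeff_eq_zero_of_natDegree_lt hm

theorem isHomogeneous_of_dvd {A : MvPolynomial σ R} (hG : G.IsHomogeneous n) (h0 : G ≠ 0)
    (h : A ∣ G) : ∃ a, A.IsHomogeneous a := by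
  obtain ⟨B, rfl⟩ := h
  exact isHomogeneous_of_mul hG h0

theorem isHomogeneous_right_of_mul {A B : MvPolynomial σ R} {a : ℕ} (hA : A.IsHomogeneous a)
    (hA0 : A ≠ 0) (h : (A * B).IsHomogeneous n) : B.IsHomogeneous (n - a) := by
  obtain rfl | hB0 := eq_or_ne B 0
  · exact isHomogeneous_zero _ _ _
  obtain ⟨b, hb⟩ := isHomogeneous_of_mul (mul_comm A B ▸ h) (mul_ne_zero hB0 hA0)
  rwa [← (hA.mul hb).inj_right h (mul_ne_zero hA0 hB0), Nat.add_sub_cancel_left]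

end Homogeneous

section Forms

variable {σ τ R : Type*} [CommRing R] {A G H : MvPolynomial σ R}

/-- A form: a homogeneous polynomial, of an unspecified degree. -/
def IsForm (G : MvPolynomial σ R) : Prop := ∃ n, G.IsHomogeneous n

/-- An irreducible form. For `R = ℂ` these are the equations of the irreducible hypersurfaces. -/
structure IsIrreducibleForm (A : MvPolynomial σ R) : Prop where
  isForm : IsForm A
  irreducible : Irreducible A

theorem IsForm.mul (hG : IsForm G) (hH : IsForm H) : IsForm (G * H) :=
  ⟨_, hG.choose_spec.mul hH.choose_spec⟩

theorem isForm_C_mul_X_sub (a b : R) (i j : σ) : IsForm (C a * X i - C b * X j) :=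
  ⟨1, (isHomogeneous_C_mul_X a i).sub (isHomogeneous_C_mul_X b j)⟩

theorem IsForm.of_dvd [IsDomain R] (hG : IsForm G) (h0 : G ≠ 0) (h : A ∣ G) : IsForm A :=
  isHomogeneous_of_dvd hG.choose_spec h0 h

theorem not_isUnit_of_isHomogeneous [IsDomain R] {n : ℕ} (hn : 0 < n) (hG : G.IsHomogeneous n) :
    ¬ IsUnit G := by
  intro hu
  have hdeg := hG.totalDegree hu.ne_zero
  rw [(isUnit_iff_totalDegree_of_isReduced.mp hu).2] at hdeg
  exact hn.ne hdeg

end Forms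

section Field

variable {σ K : Type*} [Field K] {A G : MvPolynomial σ K}

theorem IsIrreducibleForm.exists_isHomogeneous (hA : IsIrreducibleForm A) :
    ∃ a, 0 < a ∧ A.IsHomogeneous a := by
  obtain ⟨a, ha⟩ := hA.isForm
  refine ⟨a, Nat.pos_of_ne_zero ?_, ha⟩
  rintro rfl
  obtain ⟨c, rfl⟩ : ∃ c, A = C c :=
    ⟨_, totalDegree_eq_zero_iff_eq_C.mp ((totalDegree_zero_iff_isHomogeneous σ).mpr ha)⟩
  have hc : c ≠ 0 := fun h => hA.irreducible.ne_zero (by rw [h, C_0])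
  exact hA.irreducible.not_isUnit ((IsUnit.mk0 c hc).map C)

theorem dvd_C_mul_iff {c : K} (hc : c ≠ 0) : A ∣ C c * G ↔ A ∣ G :=
  ((IsUnit.mk0 c hc).map C).dvd_mul_left

theorem exists_isIrreducibleForm_dvd (hG : IsForm G) (h0 : G ≠ 0) (hu : ¬ IsUnit G) :
    ∃ A, IsIrreducibleForm A ∧ A ∣ G := by
  obtain ⟨A, hA, hAG⟩ := WfDvdMonoid.exists_irreducible_factor hu h0
  exact ⟨A, ⟨hG.of_dvd h0 hAG, hA⟩, hAG⟩

theorem exists_isIrreducibleForm_mem_dvd {I : Ideal (MvPolynomial σ K)} (hI : I.IsPrime)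
    (hG : IsForm G) (h0 : G ≠ 0) (hGI : G ∈ I) : ∃ A ∈ I, IsIrreducibleForm A ∧ A ∣ G := by
  obtain ⟨f, hprime, hprod⟩ := UniqueFactorizationMonoid.exists_prime_factors G h0
  obtain ⟨A, hAf, hAI⟩ :=
    (hI.multiset_prod_mem_iff_exists_mem f).mp (I.mem_of_dvd hprod.symm.dvd hGI)
  have hAG : A ∣ G := (Multiset.dvd_prod hAf).trans hprod.dvd
  exact ⟨A, hAI, ⟨hG.of_dvd h0 hAG, (hprime A hAf).irreducible⟩, hAG⟩

theorem irreducible_of_isHomogeneous_one (hG : G.IsHomogeneous 1) (h0 : G ≠ 0) :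
    Irreducible G := by
  obtain ⟨d, hd⟩ := exists_coeff_ne_zero h0
  exact irreducible_of_totalDegree_eq_one (hG.totalDegree h0) fun c hc =>
    isUnit_of_dvd_unit (hc d) (IsUnit.mk0 _ hd)

theorem irreducible_C_mul_X_sub {a b : K} (ha : a ≠ 0) {i j : σ} (hij : i ≠ j) :
    Irreducible (C a * X i - C b * X j : MvPolynomial σ K) := by
  refine irreducible_of_isHomogeneous_one
    ((isHomogeneous_C_mul_X a i).sub (isHomogeneous_C_mul_X b j)) fun h0 => ha ?_
  classical simpa [hij.symm] using congrArg (eval (Pi.single i 1)) h0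

theorem isIrreducibleForm_sum_C_mul_X [Fintype σ] {a : σ → K} (ha : a ≠ 0) :
    IsIrreducibleForm (∑ i, C (a i) * X i) := by
  have hhom : (∑ i, C (a i) * X i : MvPolynomial σ K).IsHomogeneous 1 :=
    .sum _ _ _ fun i _ => isHomogeneous_C_mul_X (a i) i
  refine ⟨⟨1, hhom⟩, irreducible_of_isHomogeneous_one hhom fun h0 => ha (_root_.funext fun i => ?_)⟩
  classical simpa [Pi.single_apply] using congrArg (eval (Pi.single i 1)) h0

end Field

section ZeroLocus

variable {k : ℕ} {A G : Poly k} {V : Set (PSpace k)} {p : PSpace k}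

theorem mem_zeroLocus_iff : p ∈ zeroLocus G ↔ eval p.rep G = 0 := Iff.rfl

theorem IsForm.mk_mem_zeroLocus_iff (hG : IsForm G) {v : Fin (k + 1) → ℂ} (hv : v ≠ 0) :
    Projectivization.mk ℂ v hv ∈ zeroLocus G ↔ eval v G = 0 :=
  mk_mem_zeroLocus hG.choose_spec v hv

theorem zeroLocus_subset_zeroLocus_of_dvd (h : A ∣ G) : zeroLocus A ⊆ zeroLocus G := by
  obtain ⟨B, rfl⟩ := h
  intro p hp
  rw [mem_zeroLocus_iff, map_mul, mem_zeroLocus_iff.mp hp, zero_mul]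

theorem isIrreducibleHypersurface_iff :
    IsIrreducibleHypersurface V ↔ ∃ A, IsIrreducibleForm A ∧ V = zeroLocus A :=
  ⟨fun ⟨A, _, hA, hirr, hV⟩ => ⟨A, ⟨⟨_, hA⟩, hirr⟩, hV⟩,
    fun ⟨A, ⟨⟨_, hA⟩, hirr⟩, hV⟩ => ⟨A, _, hA, hirr, hV⟩⟩

theorem IsIrreducibleForm.isIrreducibleHypersurface (hA : IsIrreducibleForm A) :
    IsIrreducibleHypersurface (zeroLocus A) :=
  isIrreducibleHypersurface_iff.mpr ⟨A, hA, rfl⟩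

theorem IsIrreducibleForm.isHypersurface (hA : IsIrreducibleForm A) :
    IsHypersurface (zeroLocus A) := by
  obtain ⟨a, hpos, ha⟩ := hA.exists_isHomogeneous
  exact ⟨A, a, hpos, ha, hA.irreducible.ne_zero, rfl⟩

theorem IsHypersurface.exists_isIrreducibleForm (hV : IsHypersurface V) :
    ∃ A, IsIrreducibleForm A ∧ zeroLocus A ⊆ V := by
  obtain ⟨G, e, he, hG, h0, rfl⟩ := hV
  obtain ⟨A, hA, hAG⟩ := exists_isIrreducibleForm_dvd ⟨e, hG⟩ h0 (not_isUnit_of_isHomogeneous he hG)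
  exact ⟨A, hA, zeroLocus_subset_zeroLocus_of_dvd hAG⟩

theorem exists_not_dvd_X {σ K : Type*} [Field K] [Nontrivial σ] {A : MvPolynomial σ K}
    (hA : Irreducible A) : ∃ i, ¬ A ∣ X i := by
  by_contra! h
  obtain ⟨i, j, hij⟩ := exists_pair_ne σ
  exact hij (X_dvd_X.mp ((hA.dvd_symm X_prime.irreducible (h i)).trans (h j)))

theorem noCommonFactor_X [NeZero k] : NoCommonFactor (X : PolyMap k) := by
  intro A hA
  by_contra hu
  obtain ⟨B, hB, hBA⟩ := WfDvdMonoid.exists_irreducible_factor hu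
    (ne_zero_of_dvd_ne_zero (X_ne_zero 0) (hA 0))
  obtain ⟨i, hi⟩ := exists_not_dvd_X hB
  exact hi (hBA.trans (hA i))

/-- A form that vanishes on the projective zero locus need not vanish at the origin; its products
with the coordinates do. -/
theorem IsIrreducibleForm.zeroLocus_subset_zeroLocus_iff [NeZero k] (hA : IsIrreducibleForm A)
    (hG : IsForm G) : zeroLocus A ⊆ zeroLocus G ↔ A ∣ G := by
  refine ⟨fun h => ?_, zeroLocus_subset_zeroLocus_of_dvd⟩
  have hprime : (Ideal.span {A}).IsPrime :=
    (Ideal.span_singleton_prime hA.irreducible.ne_zero).mpr hA.irreducible.prime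
  have hmul (i : Fin (k + 1)) : A ∣ G * X i := by
    rw [← Ideal.mem_span_singleton, ← MvPolynomial.IsPrime.vanishingIdeal_zeroLocus (K := ℂ)
      (Ideal.span {A}), mem_vanishingIdeal_iff]
    intro x hx
    change eval x (G * X i) = 0
    rw [map_mul]
    obtain rfl | hx0 := eq_or_ne x 0
    · simp
    · have hxA : eval x A = 0 := hx A (Ideal.mem_span_singleton_self A)
      rw [(hG.mk_mem_zeroLocus_iff hx0).mp (h ((hA.isForm.mk_mem_zeroLocus_iff hx0).mpr hxA)),
        zero_mul]
  obtain ⟨i, hi⟩ := exists_not_dvd_X hA.irreducible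
  exact (hA.irreducible.prime.dvd_or_dvd (hmul i)).resolve_right hi

end ZeroLocus

section Restriction

variable {ι σ τ K : Type*} [Field K] {A : MvPolynomial σ K} {F Φ : ι → MvPolynomial σ K}
  {v : ι → K}

/-- The components of `F` are forms of one and the same degree. -/
def IsFormMap (F : ι → MvPolynomial σ K) : Prop := ∃ d, ∀ i, (F i).IsHomogeneous d

/-- On the hypersurface `{A = 0}`, the map `F` is proportional to the constant vector `v`. -/
def ConstMod (A : MvPolynomial σ K) (F : ι → MvPolynomial σ K) (v : ι → K) : Prop :=
  ∀ i j, A ∣ C (v i) * F j - C (v j) * F i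

/-- The map induced by `F` on the hypersurface `{A = 0}` is defined and is not constant. -/
def NonConstMod (A : MvPolynomial σ K) (F : ι → MvPolynomial σ K) : Prop :=
  ∀ v, v ≠ 0 → ¬ ConstMod A F v

/-- The map induced by `F` sends the hypersurface `{A = 0}` onto the hypersurface `{B = 0}`,
expressed by the forms in the ideals of the two hypersurfaces. -/
structure MapsOnto (F : ι → MvPolynomial σ K) (A : MvPolynomial σ K) (B : MvPolynomial ι K) :
    Prop where
  isIrreducibleForm : IsIrreducibleForm B
  dvd_bind₁_iff : ∀ G, IsForm G → (A ∣ bind₁ F G ↔ B ∣ G)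

theorem IsFormMap.isForm (hF : IsFormMap F) (i : ι) : IsForm (F i) :=
  ⟨_, hF.choose_spec i⟩

theorem IsForm.bind₁ {G : MvPolynomial ι K} (hG : IsForm G) (hF : IsFormMap F) :
    IsForm (bind₁ F G) :=
  ⟨_, hG.choose_spec.aeval _ hF.choose_spec⟩

theorem isFormMap_X : IsFormMap (X : σ → MvPolynomial σ K) := ⟨1, isHomogeneous_X K⟩

theorem IsFormMap.comp {F : τ → MvPolynomial ι K} (hF : IsFormMap F) (hΦ : IsFormMap Φ) :
    IsFormMap fun i => bind₁ Φ (F i) :=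
  ⟨_, fun i => (hF.choose_spec i).aeval _ hΦ.choose_spec⟩

theorem constMod_mul_iff {c : MvPolynomial σ K} (hA : Prime A) (hc : ¬ A ∣ c) :
    ConstMod A (fun i => c * F i) v ↔ ConstMod A F v := by
  refine forall₂_congr fun i j => ?_
  rw [show C (v i) * (c * F j) - C (v j) * (c * F i) = c * (C (v i) * F j - C (v j) * F i) by ring]
  exact ⟨fun h => (hA.dvd_or_dvd h).resolve_left hc, fun h => h.mul_left c⟩

theorem constMod_of_forall_dvd (h : ∀ i, A ∣ F i) : ConstMod A F v := fun i j =>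
  dvd_sub ((h j).mul_left _) ((h i).mul_left _)

theorem NonConstMod.exists_not_dvd [Nonempty ι] (h : NonConstMod A F) : ∃ i, ¬ A ∣ F i := by
  by_contra! hdvd
  exact h 1 one_ne_zero (constMod_of_forall_dvd hdvd)

theorem ConstMod.dvd_iff (hv : v ≠ 0) (h : ConstMod A F v) (hF : ∃ i, ¬ A ∣ F i) {l : ι} :
    A ∣ F l ↔ v l = 0 := by
  refine ⟨fun hl => ?_, fun hl => ?_⟩
  · by_contra h0
    obtain ⟨i, hi⟩ := hF
    exact hi ((dvd_C_mul_iff h0).mp ((dvd_sub_left (hl.mul_left _)).mp (h l i)))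
  · obtain ⟨j, hj⟩ := Function.ne_iff.mp hv
    rw [← dvd_C_mul_iff hj]
    simpa only [hl, C_0, zero_mul, sub_zero] using h j l

theorem dvd_bind₁_sub_bind₁ {σ τ R : Type*} [CommRing R] {A : MvPolynomial τ R}
    {X Y : σ → MvPolynomial τ R} (h : ∀ i, A ∣ X i - Y i) (G : MvPolynomial σ R) :
    A ∣ bind₁ X G - bind₁ Y G := by
  let π := Ideal.Quotient.mkₐ R (Ideal.span {A})
  have hπ (H H') : π H = π H' ↔ A ∣ H - H' := by
    rw [← Ideal.mem_span_singleton]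
    exact Ideal.Quotient.eq
  rw [← hπ]
  have hcomp : π.comp (MvPolynomial.bind₁ X) = π.comp (MvPolynomial.bind₁ Y) :=
    algHom_ext fun i => by simpa using (hπ _ _).mpr (h i)
  exact DFunLike.congr_fun hcomp G

theorem ConstMod.dvd_bind₁_iff (hA : Prime A) (hv : v ≠ 0) (h : ConstMod A F v)
    (hF : ∃ i, ¬ A ∣ F i) {G : MvPolynomial ι K} (hG : IsForm G) :
    A ∣ MvPolynomial.bind₁ F G ↔ eval v G = 0 := by
  obtain ⟨l, hl⟩ := Function.ne_iff.mp hv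
  obtain ⟨n, hn⟩ := hG
  have hmod := dvd_bind₁_sub_bind₁ (X := fun i => C (v l) * F i) (Y := fun i => F l * C (v i))
    (fun i => by simpa only [mul_comm (F l)] using h l i) G
  rw [bind₁_mul_of_isHomogeneous hn, bind₁_mul_of_isHomogeneous hn, ← C_pow,
    show MvPolynomial.bind₁ (fun i => C (v i)) G = C (eval v G) from
      aeval_algebraMap_apply (MvPolynomial σ K) v G] at hmod
  have hFl : ¬ A ∣ F l ^ n := fun hd => hl ((h.dvd_iff hv hF).mp (hA.dvd_of_dvd_pow hd))
  rw [← dvd_C_mul_iff (pow_ne_zero n hl), dvd_iff_dvd_of_dvd_sub hmod]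
  refine ⟨fun hd => ?_, fun h0 => by simp [h0]⟩
  by_contra h0
  rw [mul_comm, dvd_C_mul_iff h0] at hd
  exact hFl hd

theorem mapsOnto_X (hA : IsIrreducibleForm A) : MapsOnto X A A :=
  ⟨hA, fun G _ => by rw [bind₁_X_left, AlgHom.id_apply]⟩

theorem MapsOnto.comp {B : MvPolynomial ι K} {F : τ → MvPolynomial ι K} {D : MvPolynomial τ K}
    (hΦ : MapsOnto Φ A B) (h : MapsOnto F B D) (hF : IsFormMap F) :
    MapsOnto (fun i => bind₁ Φ (F i)) A D :=
  ⟨h.isIrreducibleForm, fun G hG => by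
    rw [← bind₁_bind₁, hΦ.dvd_bind₁_iff _ (hG.bind₁ hF), h.dvd_bind₁_iff G hG]⟩

theorem MapsOnto.exists_not_dvd [Nontrivial ι] {B : MvPolynomial ι K} (h : MapsOnto Φ A B) :
    ∃ i, ¬ A ∣ Φ i := by
  obtain ⟨i, hi⟩ := exists_not_dvd_X h.isIrreducibleForm.irreducible
  exact ⟨i, by rwa [← bind₁_X_right Φ i, h.dvd_bind₁_iff _ ⟨1, isHomogeneous_X K i⟩]⟩

theorem MapsOnto.of_mul [Nontrivial ι] {B : MvPolynomial ι K} {c : MvPolynomial σ K}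
    (h : MapsOnto (fun i => c * Φ i) A B) (hA : Prime A) : MapsOnto Φ A B := by
  refine ⟨h.isIrreducibleForm, fun G hG => ?_⟩
  obtain ⟨i, hi⟩ := h.exists_not_dvd
  rw [← h.dvd_bind₁_iff G hG, bind₁_mul_of_isHomogeneous hG.choose_spec, hA.dvd_mul]
  exact (or_iff_right fun hd => hi ((hA.dvd_of_dvd_pow hd).mul_right _)).symm

theorem MapsOnto.constMod_comp_iff {B : MvPolynomial ι K} {F : τ → MvPolynomial ι K} {v : τ → K}
    (h : MapsOnto Φ A B) (hF : IsFormMap F) :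
    ConstMod A (fun i => bind₁ Φ (F i)) v ↔ ConstMod B F v := by
  refine forall₂_congr fun i j => ?_
  obtain ⟨d, hd⟩ := hF
  rw [← h.dvd_bind₁_iff _ ⟨d, ((hd j).C_mul _).sub ((hd i).C_mul _)⟩, map_sub, map_mul, map_mul,
    bind₁_C_right, bind₁_C_right]

theorem nonConstMod_X {k : ℕ} [k.AtLeastTwo] {A : Poly k} (hA : Irreducible A) :
    NonConstMod A X := by
  intro v hv h
  obtain ⟨l, hl⟩ := Function.ne_iff.mp hv
  have hk : 2 < k + 1 := Nat.succ_lt_succ Nat.AtLeastTwo.one_lt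
  obtain ⟨i, hil, -⟩ := Fin.exists_ne_and_ne_of_two_lt l l hk
  obtain ⟨j, hjl, hji⟩ := Fin.exists_ne_and_ne_of_two_lt l i hk
  have hdvd : (C (v l) * X i - C (v i) * X l : Poly k) ∣ C (v l) * X j - C (v j) * X l :=
    (hA.dvd_symm (irreducible_C_mul_X_sub hl hil) (h l i)).trans (h l j)
  have heval := (eval (Pi.single j 1)).map_dvd hdvd
  refine hl ?_
  simpa [hji.symm, hjl.symm, zero_dvd_iff] using heval

end Restriction

section Image

variable {k : ℕ} {A B G : Poly k} {F : PolyMap k} {v : Fin (k + 1) → ℂ} {V W : Set (PSpace k)}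
  {p : PSpace k}

theorem subset_zariskiClosure : V ⊆ zariskiClosure V :=
  fun _ hp _ _ _ h => h hp

theorem image_mono (h : V ⊆ W) : image F V ⊆ image F W := by
  intro p hp G e hG hS
  refine hp G e hG (subset_trans ?_ hS)
  rintro p ⟨q, hq, h0, rfl⟩
  exact ⟨q, h hq, h0, rfl⟩

theorem mem_image_iff :
    p ∈ image F V ↔ ∀ G, IsForm G → image F V ⊆ zeroLocus G → p ∈ zeroLocus G :=
  ⟨fun hp _ _ h => h hp, fun h G n hG hS => h G ⟨n, hG⟩ fun _ hq => hq G n hG hS⟩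

/-- Multiplying the pullback of `G` by the components of `F` discards the points at which `F` is
not defined. -/
theorem image_subset_zeroLocus_iff_forall_mul (hG : IsForm G) :
    image F V ⊆ zeroLocus G ↔ ∀ i, V ⊆ zeroLocus (bind₁ F G * F i) := by
  have heval (q : PSpace k) : eval q.rep (bind₁ F G) = eval (evalMap F q.rep) G := eval_bind₁ ..
  refine ⟨fun h i q hq => ?_, fun h p hp => ?_⟩
  · rw [mem_zeroLocus_iff, map_mul, mul_eq_zero, or_iff_not_imp_right]
    intro hi
    have h0 : evalMap F q.rep ≠ 0 := fun h0 => hi (congrFun h0 i)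
    rw [heval, ← hG.mk_mem_zeroLocus_iff h0]
    exact h (subset_zariskiClosure ⟨q, hq, h0, rfl⟩)
  · obtain ⟨n, hn⟩ := hG
    refine hp G n hn ?_
    rintro _ ⟨q, hq, h0, rfl⟩
    obtain ⟨i, hi⟩ := Function.ne_iff.mp h0
    rw [mk_mem_zeroLocus hn, ← heval]
    have hmul := h i hq
    rw [mem_zeroLocus_iff, map_mul] at hmul
    exact (mul_eq_zero.mp hmul).resolve_right hi

theorem image_subset_zeroLocus_iff [NeZero k] (hA : IsIrreducibleForm A) (hF : IsFormMap F)
    (hAF : ∃ i, ¬ A ∣ F i) (hG : IsForm G) :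
    image F (zeroLocus A) ⊆ zeroLocus G ↔ A ∣ bind₁ F G := by
  rw [image_subset_zeroLocus_iff_forall_mul hG]
  simp only [hA.zeroLocus_subset_zeroLocus_iff ((hG.bind₁ hF).mul (hF.isForm _))]
  obtain ⟨i, hi⟩ := hAF
  exact ⟨fun h => (hA.irreducible.prime.dvd_or_dvd (h i)).resolve_right hi,
    fun h j => h.mul_right _⟩

theorem MapsOnto.image_eq [NeZero k] (h : MapsOnto F A B) (hA : IsIrreducibleForm A)
    (hF : IsFormMap F) : image F (zeroLocus A) = zeroLocus B := by
  have hsubset {G} (hG : IsForm G) : image F (zeroLocus A) ⊆ zeroLocus G ↔ B ∣ G := by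
    rw [image_subset_zeroLocus_iff hA hF h.exists_not_dvd hG, h.dvd_bind₁_iff G hG]
  refine ((hsubset h.isIrreducibleForm.isForm).mpr dvd_rfl).antisymm fun p hp => ?_
  exact mem_image_iff.mpr fun G hG hS =>
    zeroLocus_subset_zeroLocus_of_dvd ((hsubset hG).mp hS) hp

theorem mem_zeroLocus_C_mul_X_sub (i j : Fin (k + 1)) :
    p ∈ zeroLocus (C (v i) * X j - C (v j) * X i) ↔ v i * p.rep j = v j * p.rep i := by
  rw [mem_zeroLocus_iff]
  simp only [map_sub, map_mul, eval_C, eval_X, sub_eq_zero]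

theorem eq_mk_of_forall_mem_zeroLocus (hv : v ≠ 0)
    (h : ∀ i j, p ∈ zeroLocus (C (v i) * X j - C (v j) * X i)) :
    p = Projectivization.mk ℂ v hv := by
  obtain ⟨l, hl⟩ := Function.ne_iff.mp hv
  rw [← p.mk_rep, Projectivization.mk_eq_mk_iff']
  refine ⟨p.rep l / v l, funext fun j => ?_⟩
  rw [Pi.smul_apply, smul_eq_mul, div_mul_eq_mul_div, div_eq_iff hl, mul_comm (p.rep j),
    (mem_zeroLocus_C_mul_X_sub l j).mp (h l j), mul_comm]

theorem ConstMod.image_eq [NeZero k] (hA : IsIrreducibleForm A) (hF : IsFormMap F) (hv : v ≠ 0)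
    (h : ConstMod A F v) (hAF : ∃ i, ¬ A ∣ F i) :
    image F (zeroLocus A) = {Projectivization.mk ℂ v hv} := by
  refine Set.Subset.antisymm (fun p hp => ?_) (Set.singleton_subset_iff.mpr ?_)
  · refine eq_mk_of_forall_mem_zeroLocus hv fun i j => ?_
    refine (image_subset_zeroLocus_iff hA hF hAF (isForm_C_mul_X_sub ..)).mpr ?_ hp
    rw [map_sub, map_mul, map_mul, bind₁_C_right, bind₁_C_right, bind₁_X_right, bind₁_X_right]
    exact h i j
  · rw [mem_image_iff]
    intro G hG hS
    rwa [image_subset_zeroLocus_iff hA hF hAF hG,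
      h.dvd_bind₁_iff hA.irreducible.prime hv hAF hG, ← hG.mk_mem_zeroLocus_iff hv] at hS

theorem IsHypersurface.not_subset_singleton [k.AtLeastTwo] (hV : IsHypersurface V)
    (p : PSpace k) : ¬ V ⊆ {p} := by
  have : NeZero k := .of_gt Nat.AtLeastTwo.one_lt
  obtain ⟨A, hA, hAV⟩ := hV.exists_isIrreducibleForm
  refine fun h => nonConstMod_X hA.irreducible p.rep p.rep_nonzero fun i j => ?_
  rw [← hA.zeroLocus_subset_zeroLocus_iff (isForm_C_mul_X_sub ..)]
  intro q hq
  rw [h (hAV hq), mem_zeroLocus_C_mul_X_sub, mul_comm]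

theorem nonConstMod_of_isHypersurface_image [k.AtLeastTwo] (hA : IsIrreducibleForm A)
    (hF : IsFormMap F) (hAF : ∃ i, ¬ A ∣ F i) (h : IsHypersurface (image F (zeroLocus A))) :
    NonConstMod A F := by
  have : NeZero k := .of_gt Nat.AtLeastTwo.one_lt
  intro v hv hconst
  exact h.not_subset_singleton (Projectivization.mk ℂ v hv) (hconst.image_eq hA hF hv hAF).subset

end Image

section BinaryForms

theorem IsIrreducibleForm.zeroLocus_nonempty {k : ℕ} [NeZero k] {A : Poly k}
    (hA : IsIrreducibleForm A) : (zeroLocus A).Nonempty := by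
  by_contra! hempty
  have hsubset : zeroLocus A ⊆ zeroLocus 1 := hempty ▸ Set.empty_subset _
  rw [hA.zeroLocus_subset_zeroLocus_iff ⟨0, isHomogeneous_one _ _⟩] at hsubset
  exact hA.irreducible.not_isUnit (isUnit_of_dvd_one hsubset)

theorem IsIrreducibleForm.exists_constMod_X {A : Poly 1} (hA : IsIrreducibleForm A) :
    ∃ v, v ≠ 0 ∧ ConstMod A X v := by
  obtain ⟨p, hp⟩ := hA.zeroLocus_nonempty
  have hline {i j : Fin 2} (hij : i ≠ j) (hi : p.rep i ≠ 0) :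
      A ∣ C (p.rep i) * X j - C (p.rep j) * X i := by
    let L : Poly 1 := C (p.rep i) * X j - C (p.rep j) * X i
    have hL : IsIrreducibleForm L :=
      ⟨isForm_C_mul_X_sub .., irreducible_C_mul_X_sub hi hij.symm⟩
    refine (hL.irreducible.dvd_symm hA.irreducible
      ((hL.zeroLocus_subset_zeroLocus_iff hA.isForm).mp fun q hq => ?_))
    suffices q = p from this ▸ hp
    rw [mem_zeroLocus_C_mul_X_sub] at hq
    rw [← p.mk_rep]
    refine eq_mk_of_forall_mem_zeroLocus p.rep_nonzero fun i' j' => ?_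
    rw [mem_zeroLocus_C_mul_X_sub]
    fin_cases i <;> fin_cases j <;> fin_cases i' <;> fin_cases j' <;> grind
  refine ⟨p.rep, p.rep_nonzero, fun i j => ?_⟩
  obtain rfl | hij := eq_or_ne i j
  · rw [sub_self]
    exact dvd_zero A
  by_cases hi : p.rep i = 0
  · rw [dvd_sub_comm]
    refine hline hij.symm fun hj => p.rep_nonzero (funext fun l => ?_)
    obtain rfl | rfl : l = i ∨ l = j := by lia
    exacts [hi, hj]
  · exact hline hij hi

/-- Over an algebraically closed field a binary form is a product of linear forms, hence one of
them vanishes on `{A = 0}`. -/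
theorem exists_constMod_of_dvd_bind₁ {σ : Type*} {A : MvPolynomial σ ℂ} (hA : Prime A)
    {F : Fin 2 → MvPolynomial σ ℂ} {G : Poly 1} (hG : IsForm G) (h0 : G ≠ 0)
    (h : A ∣ bind₁ F G) : ∃ v, v ≠ 0 ∧ ConstMod A F v := by
  have hprime : ((Ideal.span {A}).comap (bind₁ F)).IsPrime :=
    have := (Ideal.span_singleton_prime hA.ne_zero).mpr hA
    Ideal.comap_isPrime _ _
  obtain ⟨L, hLmem, hL, -⟩ := exists_isIrreducibleForm_mem_dvd hprime hG h0
    (Ideal.mem_span_singleton.mpr h)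
  have hAL : A ∣ bind₁ F L := Ideal.mem_span_singleton.mp hLmem
  obtain ⟨v, hv, hconst⟩ := hL.exists_constMod_X
  refine ⟨v, hv, fun i j => hAL.trans ?_⟩
  simpa only [map_sub, map_mul, bind₁_C_right, bind₁_X_right] using
    map_dvd (bind₁ F) (hconst i j)

end BinaryForms

section TranscendenceDegree

theorem injective_of_algebraicIndependent_comp {K ι R S : Type*} [Field K] [Finite ι] [CommRing R]
    [IsDomain R] [Algebra K R] [CommRing S] [Algebra K S] (f : R →ₐ[K] S) {x : ι → R}
    (hx : AlgebraicIndependent K (f ∘ x)) (htrdeg : Algebra.trdeg K R ≤ Nat.card ι) :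
    Function.Injective f := by
  have hbasis := (hx.of_comp f).isTranscendenceBasis_of_lift_trdeg_le_of_finite <| by
    rwa [← Nat.cast_card, Cardinal.lift_natCast, Cardinal.lift_le_nat_iff]
  have halg := hbasis.isAlgebraic
  rw [injective_iff_map_eq_zero]
  intro r hr
  by_contra hr0
  obtain ⟨⟨s, hs⟩, hs0, t, hst⟩ :=
    (halg.isAlgebraic r).exists_nonzero_dvd (mem_nonZeroDivisors_of_ne_zero hr0)
  rw [Algebra.adjoin_range_eq_range_aeval] at hs
  obtain ⟨p, rfl⟩ := hs
  have hp : aeval (fun i => f (x i)) p = 0 := by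
    rw [← comp_aeval_apply]
    exact zero_dvd_iff.mp (hr ▸ map_dvd f ⟨t, hst⟩)
  obtain rfl : p = 0 := (injective_iff_map_eq_zero _).mp hx p hp
  exact hs0 (Subtype.ext (map_zero (aeval x)))

theorem trdeg_quotient_lt {K σ : Type*} [Field K] [Finite σ] {I : Ideal (MvPolynomial σ K)}
    [I.IsPrime] (hI : I ≠ ⊥) : Algebra.trdeg K (MvPolynomial σ K ⧸ I) < Nat.card σ := by
  let x (i : σ) : MvPolynomial σ K ⧸ I := Ideal.Quotient.mkₐ K I (X i)
  have haeval : aeval x = Ideal.Quotient.mkₐ K I := algHom_ext fun i => aeval_X x i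
  by_contra! htrdeg
  have halg : Algebra.IsAlgebraic (Algebra.adjoin K (Set.range x)) (MvPolynomial σ K ⧸ I) := by
    rw [Algebra.adjoin_range_eq_range_aeval, haeval,
      (AlgHom.range_eq_top _).mpr (Ideal.Quotient.mkₐ_surjective K I)]
    exact ⟨fun y => isAlgebraic_algebraMap (⟨y, trivial⟩ : (⊤ : Subalgebra K _))⟩
  have hbasis := Algebra.IsAlgebraic.isTranscendenceBasis_of_lift_le_trdeg_of_finite K x <| by
    rwa [← Nat.cast_card, Cardinal.lift_natCast, Cardinal.nat_le_lift_iff]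
  have hinj := hbasis.1
  rw [AlgebraicIndependent, haeval] at hinj
  exact hI (Ideal.Quotient.mkₐ_ker K I ▸ (RingHom.injective_iff_ker_eq_bot _).mp hinj)

end TranscendenceDegree

section ImageCurve

variable {ι σ K : Type*} [Field K] {A : MvPolynomial σ K} {F : ι → MvPolynomial σ K}

theorem dvd_homogeneousComponent (hA : IsForm A) {G : MvPolynomial σ K} (h : A ∣ G) (n : ℕ) :
    A ∣ homogeneousComponent n G := by
  rw [← Ideal.mem_span_singleton] at h ⊢
  let _ : GradedAlgebra (homogeneousSubmodule σ K) := MvPolynomial.gradedAlgebra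
  refine homogeneousComponent_mem_of_mem (Ideal.homogeneous_span _ _ fun x hx => ?_) h n
  rw [Set.mem_singleton_iff.mp hx]
  exact hA

theorem homogeneousComponent_bind₁ {e : ℕ} (hF : ∀ i, (F i).IsHomogeneous e) (he : 0 < e)
    (G : MvPolynomial ι K) (n : ℕ) :
    homogeneousComponent (e * n) (bind₁ F G) = bind₁ F (homogeneousComponent n G) := by
  have hcomp (m : ℕ) : homogeneousComponent (e * n) (bind₁ F (homogeneousComponent m G)) =
      if m = n then bind₁ F (homogeneousComponent m G) else 0 := by
    have hm : (bind₁ F (homogeneousComponent m G)).IsHomogeneous (e * m) :=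
      (homogeneousComponent_isHomogeneous m G).aeval _ hF
    rw [homogeneousComponent_of_mem hm]
    simp only [mul_right_inj' he.ne', eq_comm]
  conv_lhs => rw [← sum_homogeneousComponent G, map_sum, map_sum]
  rw [Finset.sum_congr rfl fun m _ => hcomp m, Finset.sum_ite_eq', ite_eq_left_iff]
  intro hn
  rw [homogeneousComponent_eq_zero _ _ (by simpa using hn), map_zero]

theorem exists_isForm_dvd_bind₁ (hA : IsForm A) {e : ℕ} (hF : ∀ i, (F i).IsHomogeneous e)
    (he : 0 < e) {G : MvPolynomial ι K} (hG : G ≠ 0) (h : A ∣ bind₁ F G) :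
    ∃ H, IsForm H ∧ H ≠ 0 ∧ A ∣ bind₁ F H := by
  obtain ⟨n, hn⟩ : ∃ n, homogeneousComponent n G ≠ 0 := by
    by_contra! hzero
    exact hG (by rw [← sum_homogeneousComponent G, Finset.sum_eq_zero fun n _ => hzero n])
  exact ⟨_, ⟨n, homogeneousComponent_isHomogeneous n G⟩, hn,
    homogeneousComponent_bind₁ hF he G n ▸ dvd_homogeneousComponent hA h _⟩

theorem NonConstMod.pos_of_isHomogeneous [Nonempty ι] (h : NonConstMod A F) {e : ℕ}
    (hF : ∀ i, (F i).IsHomogeneous e) : 0 < e := by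
  refine Nat.pos_of_ne_zero ?_
  rintro rfl
  choose c hc using fun i => (⟨_, totalDegree_eq_zero_iff_eq_C.mp
    ((totalDegree_zero_iff_isHomogeneous σ).mpr (hF i))⟩ : ∃ c, F i = C c)
  obtain ⟨i, hi⟩ := h.exists_not_dvd
  refine h c (fun h0 => hi ?_) fun i j => ?_
  · rw [hc, h0, Pi.zero_apply, C_0]
    exact dvd_zero A
  · rw [hc, hc, mul_comm, sub_self]
    exact dvd_zero A

theorem NonConstMod.exists_pair [Nonempty ι] (h : NonConstMod A F) :
    ∃ x : Fin 2 → ι, NonConstMod A (F ∘ x) := by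
  by_contra! hpair
  obtain ⟨i, hi⟩ := h.exists_not_dvd
  have hmultiple (j : ι) : ∃ c, A ∣ F j - C c * F i := by
    obtain ⟨v, hv, hconst⟩ : ∃ v, v ≠ 0 ∧ ConstMod A (F ∘ ![i, j]) v := by
      simpa [NonConstMod] using hpair ![i, j]
    have hdvd : A ∣ C (v 0) * F j - C (v 1) * F i := hconst 0 1
    have hv0 : v 0 ≠ 0 := by
      intro hv0
      have hv1 : v 1 ≠ 0 := fun hv1 => hv (funext (Fin.forall_fin_two.mpr ⟨hv0, hv1⟩))
      rw [hv0, C_0, zero_mul, zero_sub, dvd_neg, dvd_C_mul_iff hv1] at hdvd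
      exact hi hdvd
    refine ⟨v 1 / v 0, (dvd_C_mul_iff hv0).mp ?_⟩
    rwa [mul_sub, ← mul_assoc, ← C_mul, mul_div_cancel₀ _ hv0]
  choose c hc using hmultiple
  refine h c (fun h0 => hi ?_) fun j l => ?_
  · simpa [h0] using hc i
  · rw [show C (c j) * F l - C (c l) * F j =
      C (c j) * (F l - C (c l) * F i) - C (c l) * (F j - C (c j) * F i) by ring]
    exact dvd_sub ((hc l).mul_left _) ((hc j).mul_left _)

theorem NonConstMod.algebraicIndependent {A : MvPolynomial σ ℂ} {F : Fin 2 → MvPolynomial σ ℂ}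
    (h : NonConstMod A F) (hA : IsIrreducibleForm A) (hF : IsFormMap F) :
    AlgebraicIndependent ℂ fun i => Ideal.Quotient.mkₐ ℂ (Ideal.span {A}) (F i) := by
  refine (injective_iff_map_eq_zero _).mpr fun G hG => ?_
  rw [← comp_aeval_apply] at hG
  have hdvd : A ∣ bind₁ F G := Ideal.mem_span_singleton.mp (Ideal.Quotient.eq_zero_iff_mem.mp hG)
  by_contra h0
  obtain ⟨e, he⟩ := hF
  obtain ⟨H, hH, hH0, hAH⟩ :=
    exists_isForm_dvd_bind₁ hA.isForm he (h.pos_of_isHomogeneous he) h0 hdvd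
  obtain ⟨v, hv, hconst⟩ := exists_constMod_of_dvd_bind₁ hA.irreducible.prime hH hH0 hAH
  exact h v hv hconst

theorem IsIrreducibleForm.isPrime_span (hA : IsIrreducibleForm A) : (Ideal.span {A}).IsPrime :=
  (Ideal.span_singleton_prime hA.irreducible.ne_zero).mpr hA.irreducible.prime

theorem IsIrreducibleForm.trdeg_lt [Finite σ] (hA : IsIrreducibleForm A) :
    Algebra.trdeg K (MvPolynomial σ K ⧸ Ideal.span {A}) < Nat.card σ :=
  have := hA.isPrime_span
  trdeg_quotient_lt (Ideal.span_singleton_eq_bot.not.mpr hA.irreducible.ne_zero)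

theorem exists_isIrreducibleForm_dvd_bind₁ {k : ℕ} {A : Poly k} {F : PolyMap k}
    (hA : IsIrreducibleForm A) (hF : IsFormMap F) (h : NonConstMod A F) :
    ∃ B, IsIrreducibleForm B ∧ A ∣ bind₁ F B := by
  let φ : Poly k →ₐ[ℂ] Poly k ⧸ Ideal.span {A} := (Ideal.Quotient.mkₐ ℂ _).comp (bind₁ F)
  have hφ (G : Poly k) : φ G = 0 ↔ A ∣ bind₁ F G :=
    Ideal.Quotient.eq_zero_iff_mem.trans Ideal.mem_span_singleton
  obtain ⟨G, hG0, hG⟩ : ∃ G, G ≠ 0 ∧ φ G = 0 := by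
    by_contra! hinj
    have htrdeg := trdeg_le_of_injective φ
      ((injective_iff_map_eq_zero φ).mpr fun G => not_imp_not.mp (hinj G))
    rw [MvPolynomial.trdeg_of_isDomain, Cardinal.lift_id, ← Nat.cast_card] at htrdeg
    exact htrdeg.not_gt hA.trdeg_lt
  obtain ⟨e, he⟩ := hF
  obtain ⟨H, hH, hH0, hAH⟩ :=
    exists_isForm_dvd_bind₁ hA.isForm he (h.pos_of_isHomogeneous he) hG0 ((hφ G).mp hG)
  have := hA.isPrime_span
  obtain ⟨B, hBker, hB, -⟩ :=
    exists_isIrreducibleForm_mem_dvd (RingHom.ker_isPrime φ) hH hH0 ((hφ H).mpr hAH)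
  exact ⟨B, hB, (hφ B).mp hBker⟩

theorem NonConstMod.exists_mapsOnto {A : Poly 2} {F : PolyMap 2} (h : NonConstMod A F)
    (hA : IsIrreducibleForm A) (hF : IsFormMap F) : ∃ B, MapsOnto F A B := by
  obtain ⟨B, hB, hAB⟩ := exists_isIrreducibleForm_dvd_bind₁ hA hF h
  obtain ⟨x, hx⟩ := h.exists_pair
  have hmk (C G : Poly 2) : Ideal.Quotient.mk (Ideal.span {C}) G = 0 ↔ C ∣ G :=
    Ideal.Quotient.eq_zero_iff_mem.trans Ideal.mem_span_singleton
  let φ : Poly 2 ⧸ Ideal.span {B} →ₐ[ℂ] Poly 2 ⧸ Ideal.span {A} :=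
    Ideal.quotientMapₐ _ (bind₁ F)
      ((Ideal.span_singleton_le_iff_mem _).mpr (Ideal.mem_span_singleton.mpr hAB))
  have hφ (G : Poly 2) : φ (Ideal.Quotient.mk _ G) = Ideal.Quotient.mk _ (bind₁ F G) := rfl
  have hinj : Function.Injective φ := by
    have := hB.isPrime_span
    have hφx : φ ∘ (fun i => Ideal.Quotient.mk _ (X (x i))) =
        fun i => Ideal.Quotient.mkₐ ℂ (Ideal.span {A}) ((F ∘ x) i) :=
      funext fun i => by simp [hφ]
    refine injective_of_algebraicIndependent_comp φ
      (hφx ▸ hx.algebraicIndependent hA ⟨_, fun i => hF.choose_spec (x i)⟩) ?_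
    rw [← Order.lt_succ_iff, Cardinal.succ_natCast]
    simpa only [Nat.card_fin, Nat.cast_add_one] using hB.trdeg_lt
  refine ⟨B, hB, fun G _ => ?_⟩
  rw [← hmk, ← hφ, map_eq_zero_iff φ hinj, hmk]

end ImageCurve

section CommonFactors

variable {k : ℕ} {F G : PolyMap k} {A c d : Poly k}

theorem NoCommonFactor.exists_not_dvd (hF : NoCommonFactor F) (hA : ¬ IsUnit A) :
    ∃ i, ¬ A ∣ F i := by
  by_contra! h
  exact hA (hF A h)

theorem NoCommonFactor.exists_ne_zero (hF : NoCommonFactor F) : ∃ i, F i ≠ 0 := by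
  simpa only [zero_dvd_iff] using hF.exists_not_dvd not_isUnit_zero

theorem noCommonFactor_of_isIrreducibleForm (hF : IsFormMap F) (h0 : ∃ i, F i ≠ 0)
    (h : ∀ A, IsIrreducibleForm A → ∃ i, ¬ A ∣ F i) : NoCommonFactor F := by
  intro D hD
  obtain ⟨i, hi⟩ := h0
  have hDform := (hF.isForm i).of_dvd hi (hD i)
  by_contra hu
  obtain ⟨A, hA, hAD⟩ :=
    exists_isIrreducibleForm_dvd hDform (ne_zero_of_dvd_ne_zero hi (hD i)) hu
  obtain ⟨j, hj⟩ := h A hA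
  exact hj (hAD.trans (hD j))

theorem MapsOnto.exists_not_dvd_bind₁ {B : Poly k} (h : MapsOnto G A B) (hF : NoCommonFactor F)
    (hform : IsFormMap F) : ∃ i, ¬ A ∣ bind₁ G (F i) := by
  obtain ⟨i, hi⟩ := hF.exists_not_dvd h.isIrreducibleForm.irreducible.not_isUnit
  exact ⟨i, by rwa [h.dvd_bind₁_iff _ (hform.isForm i)]⟩

theorem exists_eq_mul_noCommonFactor (hG : ∃ i, G i ≠ 0) :
    ∃ c F, c ≠ 0 ∧ NoCommonFactor F ∧ ∀ i, G i = c * F i := by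
  let _ := Classical.arbitrary (NormalizedGCDMonoid (Poly k))
  obtain ⟨F, hGF, hF⟩ := Finset.extract_gcd G Finset.univ_nonempty
  refine ⟨Finset.univ.gcd G, F, fun h0 => ?_, fun A hA => ?_, fun i => hGF i (Finset.mem_univ i)⟩
  · obtain ⟨i, hi⟩ := hG
    exact hi (Finset.gcd_eq_zero_iff.mp h0 i (Finset.mem_univ i))
  · exact isUnit_of_dvd_one (hF ▸ Finset.dvd_gcd fun i _ => hA i)

theorem NoCommonFactor.dvd_of_forall_dvd_mul (hF : NoCommonFactor F) (hc : c ≠ 0)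
    (h : ∀ i, c ∣ d * F i) : c ∣ d := by
  induction c using UniqueFactorizationMonoid.induction_on_prime generalizing d with
  | h₁ => exact absurd rfl hc
  | h₂ x hx => exact hx.dvd
  | h₃ x q hx hq ih =>
    obtain ⟨i, hi⟩ := hF.exists_not_dvd hq.not_isUnit
    obtain ⟨d', rfl⟩ := (hq.dvd_or_dvd ((dvd_mul_right _ _).trans (h i))).resolve_right hi
    refine mul_dvd_mul_left q (ih hx fun j => ?_)
    have := h j
    rwa [mul_assoc, mul_dvd_mul_iff_left hq.ne_zero] at this

theorem NoCommonFactor.C_mul (hF : NoCommonFactor F) {u : ℂ} (hu : u ≠ 0) :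
    NoCommonFactor fun i => C u * F i :=
  fun A hA => hF A fun i => (dvd_C_mul_iff hu).mp (hA i)

theorem isForm_of_isFormMap_mul (h : IsFormMap fun i => c * F i) (hc : c ≠ 0)
    (hF : ∃ i, F i ≠ 0) : IsForm c := by
  obtain ⟨i, hi⟩ := hF
  exact isHomogeneous_of_mul (h.choose_spec i) (mul_ne_zero hc hi)

theorem isFormMap_of_mul (h : IsFormMap fun i => c * F i) (hc : c ≠ 0)
    (hF : ∃ i, F i ≠ 0) : IsFormMap F :=
  have ⟨_, ha⟩ := isForm_of_isFormMap_mul h hc hF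
  ⟨_, fun i => isHomogeneous_right_of_mul ha hc (h.choose_spec i)⟩

end CommonFactors

section Dominance

variable {ι σ τ K : Type*} [Field K]

/-- No hypersurface contains the image of `F`. -/
def IsDominant (F : ι → MvPolynomial σ K) : Prop := ∀ G, IsForm G → bind₁ F G = 0 → G = 0

theorem isDominant_X : IsDominant (X : σ → MvPolynomial σ K) :=
  fun G _ h => by rwa [bind₁_X_left] at h

theorem IsDominant.comp {F : τ → MvPolynomial ι K} {Φ : ι → MvPolynomial σ K}
    (h : IsDominant F) (hΦ : IsDominant Φ) (hF : IsFormMap F) :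
    IsDominant fun i => bind₁ Φ (F i) :=
  fun G hG h0 => h G hG (hΦ _ (hG.bind₁ hF) (by rwa [bind₁_bind₁]))

theorem IsDominant.of_mul {F : ι → MvPolynomial σ K} {c : MvPolynomial σ K}
    (h : IsDominant fun i => c * F i) : IsDominant F :=
  fun G hG h0 => h G hG (by rw [bind₁_mul_of_isHomogeneous hG.choose_spec, h0, mul_zero])

variable {k : ℕ} {F : PolyMap k}

theorem eq_zero_of_zeroLocus_eq_univ {G : Poly k} (hG : IsForm G) (h : zeroLocus G = .univ) :
    G = 0 := by
  suffices G * X 0 = 0 from (mul_eq_zero.mp this).resolve_right (X_ne_zero 0)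
  refine funext fun x => ?_
  rw [map_mul, map_zero, eval_X]
  obtain rfl | hx := eq_or_ne x 0
  · exact mul_zero _
  · rw [(hG.mk_mem_zeroLocus_iff hx).mp (h ▸ Set.mem_univ _), zero_mul]

theorem IsDominant.image_univ (h : IsDominant F) (hF : IsFormMap F) (h0 : ∃ i, F i ≠ 0) :
    image F .univ = .univ := by
  refine Set.eq_univ_of_forall fun p => mem_image_iff.mpr fun G hG hS => ?_
  obtain ⟨i, hi⟩ := h0
  have hmul := eq_zero_of_zeroLocus_eq_univ ((hG.bind₁ hF).mul (hF.isForm i))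
    (Set.univ_subset_iff.mp ((image_subset_zeroLocus_iff_forall_mul hG).mp hS i))
  rw [h G hG ((mul_eq_zero.mp hmul).resolve_right hi), mem_zeroLocus_iff, map_zero]

end Dominance

section IterateLiftings

variable {k n : ℕ} {F Φ Ψ : PolyMap k} {V : Set (PSpace k)}

theorem polyIterate_succ (i : Fin (k + 1)) :
    polyIterate F (n + 1) i = bind₁ (polyIterate F n) (F i) := by
  rw [polyIterate]
  rfl

theorem polyIterate_one : polyIterate F 1 = F := by
  ext1 i
  rw [polyIterate_succ, polyIterate, bind₁_X_left, AlgHom.id_apply]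

theorem isFormMap_polyIterate (hF : IsFormMap F) (n : ℕ) : IsFormMap (polyIterate F n) := by
  induction n with
  | zero => exact isFormMap_X
  | succ n ih => exact hF.comp ih

theorem IsDominant.polyIterate (h : IsDominant F) (hF : IsFormMap F) (n : ℕ) :
    IsDominant (polyIterate F n) := by
  induction n with
  | zero => exact isDominant_X
  | succ n ih => exact h.comp ih hF

theorem IsIterateLifting.isFormMap (h : IsIterateLifting F n Φ) (hF : IsFormMap F) :
    IsFormMap Φ := by
  obtain ⟨hΦ, c, hc, hmul⟩ := h
  exact isFormMap_of_mul (funext hmul ▸ isFormMap_polyIterate hF n) hc hΦ.exists_ne_zero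

theorem IsIterateLifting.isDominant (h : IsIterateLifting F n Φ) (hF : IsFormMap F)
    (hdom : IsDominant F) : IsDominant Φ := by
  obtain ⟨-, c, -, hmul⟩ := h
  exact (funext hmul ▸ hdom.polyIterate hF n : IsDominant fun i => c * Φ i).of_mul

theorem isIterateLifting_zero [NeZero k] : IsIterateLifting F 0 X :=
  ⟨noCommonFactor_X, 1, one_ne_zero, fun _ => (one_mul _).symm⟩

theorem isIterateLifting_one (hF : NoCommonFactor F) : IsIterateLifting F 1 F :=
  ⟨hF, 1, one_ne_zero, fun i => by rw [polyIterate_one, one_mul]⟩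

theorem IsIterateLifting.succ (h : IsIterateLifting F n Φ) (hF : IsFormMap F)
    (hΨ : NoCommonFactor Ψ) {c : Poly k} (hc : c ≠ 0) (hmul : ∀ i, bind₁ Φ (F i) = c * Ψ i) :
    IsIterateLifting F (n + 1) Ψ := by
  obtain ⟨-, b, hb, hΦ⟩ := h
  obtain ⟨d, hd⟩ := hF
  refine ⟨hΨ, b ^ d * c, mul_ne_zero (pow_ne_zero d hb) hc, fun i => ?_⟩
  rw [polyIterate_succ, funext hΦ, bind₁_mul_of_isHomogeneous (hd i), hmul, mul_assoc]

theorem IsIterateLifting.eq_C_mul (hΦ : IsIterateLifting F n Φ) (hΨ : IsIterateLifting F n Ψ) :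
    ∃ u : ℂ, u ≠ 0 ∧ ∀ i, Ψ i = C u * Φ i := by
  obtain ⟨hΦ, b, hb, hbΦ⟩ := hΦ
  obtain ⟨hΨ, c, hc, hcΨ⟩ := hΨ
  have hcb : c ∣ b := hΦ.dvd_of_forall_dvd_mul hc fun i => ⟨Ψ i, by rw [← hbΦ, hcΨ]⟩
  have hbc : b ∣ c := hΨ.dvd_of_forall_dvd_mul hb fun i => ⟨Φ i, by rw [← hcΨ, hbΦ]⟩
  obtain ⟨u, hu⟩ := associated_of_dvd_dvd hcb hbc
  obtain ⟨r, hr, hru⟩ := isUnit_iff_eq_C_of_isReduced.mp u.isUnit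
  refine ⟨r, hr.ne_zero, fun i => mul_left_cancel₀ hc ?_⟩
  rw [← hcΨ, hbΦ, ← hu, hru, mul_assoc]

theorem IsIterateLifting.C_mul (h : IsIterateLifting F n Φ) {u : ℂ} (hu : u ≠ 0) :
    IsIterateLifting F n fun i => C u * Φ i := by
  obtain ⟨hΦ, c, hc, hmul⟩ := h
  refine ⟨hΦ.C_mul hu, c * C u⁻¹, mul_ne_zero hc (C_ne_zero.mpr (inv_ne_zero hu)), fun i => ?_⟩
  rw [hmul, mul_assoc, ← mul_assoc (C u⁻¹), ← MvPolynomial.C_mul, inv_mul_cancel₀ hu, C_1, one_mul]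

theorem image_C_mul_subset {u : ℂ} : image (fun i => C u * Φ i) V ⊆ image Φ V := by
  have heval (x) : evalMap (fun i => C u * Φ i) x = u • evalMap Φ x := by
    ext i
    simp [evalMap]
  intro p hp G e hG hS
  refine hp G e hG (subset_trans ?_ hS)
  rintro _ ⟨q, hq, h0, rfl⟩
  refine ⟨q, hq, fun h1 => h0 (by rw [heval, h1, smul_zero]), ?_⟩
  rw [Projectivization.mk_eq_mk_iff']
  exact ⟨u, (heval _).symm⟩

theorem IsIterateLifting.iterImage_eq (h : IsIterateLifting F n Φ) :
    iterImage F n V = image Φ V := by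
  refine Set.Subset.antisymm ?_ fun p hp => ⟨Φ, h, hp⟩
  rintro p ⟨Ψ, hΨ, hp⟩
  obtain ⟨u, -, hmul⟩ := h.eq_C_mul hΨ
  rw [funext hmul] at hp
  exact image_C_mul_subset hp

theorem iterImage_zero [NeZero k] {A : Poly k} (hA : IsIrreducibleForm A) :
    iterImage F 0 (zeroLocus A) = zeroLocus A := by
  rw [isIterateLifting_zero.iterImage_eq, (mapsOnto_X hA).image_eq hA isFormMap_X]

end IterateLiftings

section Contraction

theorem exists_ne_zero_dotProduct_eq_zero {ι K : Type*} [Field K] [Fintype ι]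
    (hι : 2 < Fintype.card ι) (x y : ι → K) : ∃ a : ι → K, a ≠ 0 ∧ a ⬝ᵥ x = 0 ∧ a ⬝ᵥ y = 0 := by
  let φ : (ι → K) →ₗ[K] Fin 2 → K := Matrix.mulVecLin (.of ![x, y])
  have hker : LinearMap.ker φ ≠ ⊥ :=
    LinearMap.ker_ne_bot_of_finrank_lt (by simpa [Module.finrank_fintype_fun_eq_card] using hι)
  obtain ⟨a, ha, h0⟩ := (Submodule.ne_bot_iff _).mp hker
  exact ⟨a, h0, (dotProduct_comm _ _).trans (congrFun ha 0),
    (dotProduct_comm _ _).trans (congrFun ha 1)⟩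

theorem exists_isIrreducibleForm_eval_eq_zero_dvd {σ K : Type*} [Field K] {G : MvPolynomial σ K}
    {x : σ → K} (hG : IsForm G) (h0 : G ≠ 0) (hx : eval x G = 0) :
    ∃ A, IsIrreducibleForm A ∧ eval x A = 0 ∧ A ∣ G := by
  obtain ⟨A, hAx, hA, hAG⟩ :=
    exists_isIrreducibleForm_mem_dvd (RingHom.ker_isPrime (eval x)) hG h0 hx
  exact ⟨A, hA, hAx, hAG⟩

/-- The map `F` contracts the components of `{P = 0}` to a point `v ∉ {P = 0}` at which `F` is not
defined, while `F` sends all other irreducible hypersurfaces, and the second iterate of `F` sends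
the components of `{P = 0}`, onto hypersurfaces. -/
structure ContractsToIndeterminacy {k : ℕ} (F : PolyMap k) (P : Poly k) (v : Fin (k + 1) → ℂ) :
    Prop where
  isFormMap : IsFormMap F
  noCommonFactor : NoCommonFactor F
  isHomogeneous : ∃ p, 0 < p ∧ P.IsHomogeneous p
  eval_ne_zero : eval v P ≠ 0
  evalMap_eq_zero : evalMap F v = 0
  constMod : ∀ A, IsIrreducibleForm A → A ∣ P → ConstMod A F v
  exists_mapsOnto : ∀ A, IsIrreducibleForm A → ¬ A ∣ P → ∃ B, MapsOnto F A B
  exists_mapsOnto_second : ∀ Φ, IsIterateLifting F 2 Φ → ∀ A, IsIrreducibleForm A → A ∣ P →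
    ∃ B, MapsOnto Φ A B

namespace ContractsToIndeterminacy

variable {k : ℕ} {F : PolyMap k} {P : Poly k} {v : Fin (k + 1) → ℂ}

theorem ne_zero (h : ContractsToIndeterminacy F P v) : P ≠ 0 :=
  fun h0 => h.eval_ne_zero (by rw [h0, map_zero])

theorem vector_ne_zero (h : ContractsToIndeterminacy F P v) : v ≠ 0 := by
  obtain ⟨p, hp, hP⟩ := h.isHomogeneous
  rintro rfl
  apply h.eval_ne_zero
  rw [eval_zero]
  exact hP.coeff_eq_zero (by simpa using hp.ne)

theorem eval_component_ne_zero (h : ContractsToIndeterminacy F P v) {G : Poly k} (hG : IsForm G)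
    (h0 : G ≠ 0) (hGP : ∀ A, IsIrreducibleForm A → A ∣ G → A ∣ P) : eval v G ≠ 0 := by
  intro hv
  obtain ⟨A, hA, hAv, hAG⟩ := exists_isIrreducibleForm_eval_eq_zero_dvd hG h0 hv
  exact h.eval_ne_zero (zero_dvd_iff.mp (hAv ▸ map_dvd (eval v) (hGP A hA hAG)))

/-- The preimage of an irreducible hypersurface through `F x` contains an irreducible hypersurface
through `x`, which lies outside `{P = 0}` and therefore is sent onto it. -/
theorem dvd_of_bind₁_eq_zero [NeZero k] (h : ContractsToIndeterminacy F P v)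
    {x : Fin (k + 1) → ℂ} (hx0 : x ≠ 0) (hx : eval x P ≠ 0) {G L : Poly k} (hG : IsForm G)
    (hGF : bind₁ F G = 0) (hL : IsIrreducibleForm L) (hLx : eval (evalMap F x) L = 0) : L ∣ G := by
  obtain ⟨A, hA, hAx, hAL⟩ : ∃ A, IsIrreducibleForm A ∧ eval x A = 0 ∧ A ∣ bind₁ F L := by
    by_cases h0 : bind₁ F L = 0
    · obtain ⟨l, hl⟩ := Function.ne_iff.mp hx0
      obtain ⟨j, hj⟩ := exists_ne l
      exact ⟨C (x l) * X j - C (x j) * X l,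
        ⟨isForm_C_mul_X_sub .., irreducible_C_mul_X_sub hl hj⟩, by simp [mul_comm], h0 ▸ dvd_zero _⟩
    · exact exists_isIrreducibleForm_eval_eq_zero_dvd (hL.isForm.bind₁ h.isFormMap) h0
        ((eval_bind₁ x F L).trans hLx)
  have hAP : ¬ A ∣ P := fun hAP => hx (zero_dvd_iff.mp (hAx ▸ map_dvd (eval x) hAP))
  obtain ⟨B, hB⟩ := h.exists_mapsOnto A hA hAP
  have hBL : B ∣ L := (hB.dvd_bind₁_iff L hL.isForm).mp hAL
  have hBG : B ∣ G := (hB.dvd_bind₁_iff G hG).mp (hGF ▸ dvd_zero A)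
  exact (hB.isIrreducibleForm.irreducible.dvd_symm hL.irreducible hBL).trans hBG

theorem isDominant [k.AtLeastTwo] (h : ContractsToIndeterminacy F P v) : IsDominant F := by
  intro G hG hGF
  have : NeZero k := .of_gt Nat.AtLeastTwo.one_lt
  obtain ⟨x, hx⟩ : ∃ x, eval x (P * X 0) ≠ 0 := by
    by_contra! h0
    exact mul_ne_zero h.ne_zero (X_ne_zero 0) (funext fun x => by rw [h0, map_zero])
  rw [map_mul, mul_ne_zero_iff, eval_X] at hx
  refine funext fun y => ?_
  obtain ⟨a, ha, hax, hay⟩ := exists_ne_zero_dotProduct_eq_zero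
    (by simpa using Nat.succ_lt_succ Nat.AtLeastTwo.one_lt) (evalMap F x) y
  have hdvd : ∑ j, C (a j) * X j ∣ G :=
    h.dvd_of_bind₁_eq_zero (ne_of_apply_ne (· 0) hx.2) hx.1 hG hGF
      (isIrreducibleForm_sum_C_mul_X ha) (by simpa [dotProduct] using hax)
  have hy : eval y (∑ j, C (a j) * X j) = 0 := by simpa [dotProduct] using hay
  rw [map_zero, ← zero_dvd_iff, ← hy]
  exact map_dvd (eval y) hdvd

theorem isDominantSelfMap [k.AtLeastTwo] (h : ContractsToIndeterminacy F P v) :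
    IsDominantSelfMap F :=
  ⟨h.isFormMap, h.noCommonFactor,
    h.isDominant.image_univ h.isFormMap h.noCommonFactor.exists_ne_zero⟩

/-- The common factor `H` of `F ∘ F` is supported on `{P = 0}`, since no other hypersurface is sent
into the indeterminacy locus. -/
theorem exists_second_lifting [k.AtLeastTwo] (h : ContractsToIndeterminacy F P v) :
    ∃ (H : Poly k) (Φ : PolyMap k), IsForm H ∧ H ≠ 0 ∧ eval v H ≠ 0 ∧ IsIterateLifting F 2 Φ ∧
      ∀ i, bind₁ F (F i) = H * Φ i := by
  have : NeZero k := .of_gt Nat.AtLeastTwo.one_lt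
  obtain ⟨i, hi⟩ := h.noCommonFactor.exists_ne_zero
  obtain ⟨H, Φ, hH0, hΦ, hmul⟩ := exists_eq_mul_noCommonFactor (G := fun i => bind₁ F (F i))
    ⟨i, fun h0 => hi (h.isDominant _ (h.isFormMap.isForm i) h0)⟩
  have hH : IsForm H := isForm_of_isFormMap_mul (_root_.funext hmul ▸ h.isFormMap.comp h.isFormMap)
    hH0 hΦ.exists_ne_zero
  have hHP (A : Poly k) (hA : IsIrreducibleForm A) (hAH : A ∣ H) : A ∣ P := by
    by_contra hAP
    obtain ⟨B, hB⟩ := h.exists_mapsOnto A hA hAP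
    obtain ⟨j, hj⟩ := hB.exists_not_dvd_bind₁ h.noCommonFactor h.isFormMap
    exact hj (hmul j ▸ hAH.mul_right _)
  exact ⟨H, Φ, hH, hH0, h.eval_component_ne_zero hH hH0 hHP,
    (isIterateLifting_one h.noCommonFactor).succ h.isFormMap hΦ hH0 hmul, hmul⟩

end ContractsToIndeterminacy
end Contraction

section Consecutive

variable {k n : ℕ} {F Φ Ψ : PolyMap k} {P H A c : Poly k} {v : Fin (k + 1) → ℂ}

/-- `Φ` and `Ψ` are liftings of `f^n` and `f^(n+1)`, where `f` is the map with lifting `F`; each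
irreducible hypersurface is either sent onto a hypersurface by `f^n`, or contracted to `v` by `f^n`
and sent onto a hypersurface by `f^(n+1)`. -/
structure IsConsecutive (F : PolyMap k) (v : Fin (k + 1) → ℂ) (n : ℕ) (Φ Ψ : PolyMap k) :
    Prop where
  isIterateLifting : IsIterateLifting F n Φ
  noCommonFactor : NoCommonFactor Ψ
  exists_eq_mul : ∃ c, c ≠ 0 ∧ ∀ i, bind₁ Φ (F i) = c * Ψ i
  mapsOnto_or : ∀ A, IsIrreducibleForm A →
    (∃ B, MapsOnto Φ A B) ∨ ConstMod A Φ v ∧ ∃ B, MapsOnto Ψ A B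

theorem IsConsecutive.isIterateLifting_succ (hs : IsConsecutive F v n Φ Ψ) (hF : IsFormMap F) :
    IsIterateLifting F (n + 1) Ψ :=
  have ⟨_, hc, hmul⟩ := hs.exists_eq_mul
  hs.isIterateLifting.succ hF hs.noCommonFactor hc hmul

theorem ContractsToIndeterminacy.isConsecutive_zero [NeZero k]
    (h : ContractsToIndeterminacy F P v) : IsConsecutive F v 0 X F :=
  ⟨isIterateLifting_zero, h.noCommonFactor,
    ⟨1, one_ne_zero, fun i => by rw [bind₁_X_left, AlgHom.id_apply, one_mul]⟩,
    fun A hA => .inl ⟨A, mapsOnto_X hA⟩⟩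

namespace IsConsecutive

/-- The hypersurfaces removed in the passage from `Φ` to `Ψ` are contracted by `Φ` to the point `v`,
which the pullback of `{H = 0}` avoids. -/
theorem isRelPrime_bind₁ (hs : IsConsecutive F v n Φ Ψ) (h : ContractsToIndeterminacy F P v)
    (hH : IsForm H) (hv : eval v H ≠ 0) (hc : c ≠ 0) (hmul : ∀ i, bind₁ Φ (F i) = c * Ψ i) :
    IsRelPrime (bind₁ Φ H) c := by
  have hcform : IsForm c := isForm_of_isFormMap_mul
    (_root_.funext hmul ▸ h.isFormMap.comp (hs.isIterateLifting.isFormMap h.isFormMap)) hc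
    hs.noCommonFactor.exists_ne_zero
  refine UniqueFactorizationMonoid.isRelPrime_iff_no_prime_factors hc |>.mpr ?_ |>.symm
  intro A hAc hAH hA
  have hAform : IsIrreducibleForm A := ⟨hcform.of_dvd hc hAc, hA.irreducible⟩
  have hconst : ConstMod A Φ v := by
    refine ((hs.mapsOnto_or A hAform).resolve_left fun ⟨B, hB⟩ => ?_).1
    obtain ⟨i, hi⟩ := hB.exists_not_dvd_bind₁ h.noCommonFactor h.isFormMap
    exact hi (hmul i ▸ hAc.mul_right _)
  exact hv ((hconst.dvd_bind₁_iff hA h.vector_ne_zero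
    (hs.isIterateLifting.1.exists_not_dvd hA.not_isUnit) hH).mp hAH)

theorem exists_eq_mul_second (hs : IsConsecutive F v n Φ Ψ) (h : ContractsToIndeterminacy F P v)
    (hH : IsForm H) (hv : eval v H ≠ 0) (h0 : bind₁ Φ H ≠ 0) {F₂ : PolyMap k}
    (hF₂ : ∀ i, bind₁ F (F i) = H * F₂ i) :
    ∃ (b : Poly k) (Z : PolyMap k), (∀ i, bind₁ Ψ (F i) = bind₁ Φ H * Z i) ∧
      ∀ i, bind₁ Φ (F₂ i) = b * Z i := by
  obtain ⟨c, hc, hmul⟩ := hs.exists_eq_mul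
  obtain ⟨d, hd⟩ := h.isFormMap
  have hpow (i) : c ^ d * bind₁ Ψ (F i) = bind₁ Φ H * bind₁ Φ (F₂ i) := by
    rw [← bind₁_mul_of_isHomogeneous (hd i), ← _root_.funext hmul, ← bind₁_bind₁, hF₂, map_mul]
  have hdvd (i) : bind₁ Φ H ∣ bind₁ Ψ (F i) :=
    (hs.isRelPrime_bind₁ h hH hv hc hmul).pow_right.dvd_of_dvd_mul_left ⟨_, hpow i⟩
  choose Z hZ using hdvd
  refine ⟨c ^ d, Z, hZ, fun i => mul_left_cancel₀ h0 ?_⟩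
  rw [← hpow, hZ]
  ring

theorem mapsOnto_or_succ [NeZero k] (hs : IsConsecutive F v n Φ Ψ)
    (h : ContractsToIndeterminacy F P v) {F₂ Z : PolyMap k} {b : Poly k}
    (hF₂ : IsIterateLifting F 2 F₂) (hZ : ∀ i, bind₁ Φ (F₂ i) = b * Z i)
    (hA : IsIrreducibleForm A) :
    (∃ B, MapsOnto Ψ A B) ∨ ConstMod A Ψ v ∧ ∃ B, MapsOnto Z A B := by
  obtain ⟨B, hB⟩ | ⟨-, hΨ⟩ := hs.mapsOnto_or A hA
  · obtain ⟨c, -, hmul⟩ := hs.exists_eq_mul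
    have hprime := hA.irreducible.prime
    by_cases hBP : B ∣ P
    · obtain ⟨i, hi⟩ := hB.exists_not_dvd_bind₁ h.noCommonFactor h.isFormMap
      have hAc : ¬ A ∣ c := fun hAc => hi (hmul i ▸ hAc.mul_right _)
      obtain ⟨D, hD⟩ := h.exists_mapsOnto_second F₂ hF₂ B hB.isIrreducibleForm hBP
      have hconst := (hB.constMod_comp_iff h.isFormMap).mpr (h.constMod B hB.isIrreducibleForm hBP)
      have hmaps := hB.comp hD (hF₂.isFormMap h.isFormMap)
      rw [_root_.funext hmul, constMod_mul_iff hprime hAc] at hconst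
      rw [_root_.funext hZ] at hmaps
      exact .inr ⟨hconst, D, hmaps.of_mul hprime⟩
    · obtain ⟨D, hD⟩ := h.exists_mapsOnto B hB.isIrreducibleForm hBP
      have hmaps := hB.comp hD h.isFormMap
      rw [_root_.funext hmul] at hmaps
      exact .inl ⟨D, hmaps.of_mul hprime⟩
  · exact .inl hΨ

end IsConsecutive

/-- With `H` the common factor of `F ∘ F`, so that `F ∘ F = H • F₂`, the quotient `Z` of `F ∘ Ψ` by
`H ∘ Φ` is, up to the factor discarded from `F ∘ Φ`, the composition `F₂ ∘ Φ`. -/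
theorem ContractsToIndeterminacy.exists_forall_isConsecutive_succ [k.AtLeastTwo]
    (h : ContractsToIndeterminacy F P v) :
    ∃ H, IsForm H ∧ H ≠ 0 ∧ ∀ n Φ Ψ, IsConsecutive F v n Φ Ψ →
      ∃ Z, IsConsecutive F v (n + 1) Ψ Z ∧ ∀ i, bind₁ Ψ (F i) = bind₁ Φ H * Z i := by
  have : NeZero k := .of_gt Nat.AtLeastTwo.one_lt
  obtain ⟨H, F₂, hH, hH0, hv, hF₂, hmul⟩ := h.exists_second_lifting
  refine ⟨H, hH, hH0, fun n Φ Ψ hs => ?_⟩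
  have hΦ := hs.isIterateLifting.isDominant h.isFormMap h.isDominant
  have hΨ := hs.isIterateLifting_succ h.isFormMap
  have h0 : bind₁ Φ H ≠ 0 := fun h0 => hH0 (hΦ H hH h0)
  obtain ⟨b, Z, hZ, hb⟩ := hs.exists_eq_mul_second h hH hv h0 hmul
  have hor (A) (hA : IsIrreducibleForm A) := hs.mapsOnto_or_succ h hF₂ hb hA
  obtain ⟨i, hi⟩ := h.noCommonFactor.exists_ne_zero
  have hZ0 : Z i ≠ 0 := fun hZ0 => hi
    (hΨ.isDominant h.isFormMap h.isDominant _ (h.isFormMap.isForm i) (by rw [hZ, hZ0, mul_zero]))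
  have hZform : IsFormMap Z := isFormMap_of_mul
    (_root_.funext hZ ▸ h.isFormMap.comp (hΨ.isFormMap h.isFormMap)) h0 ⟨i, hZ0⟩
  have hncf : NoCommonFactor Z := noCommonFactor_of_isIrreducibleForm hZform ⟨i, hZ0⟩ fun A hA => by
    obtain ⟨B, hB⟩ | ⟨-, B, hB⟩ := hor A hA
    · obtain ⟨j, hj⟩ := hB.exists_not_dvd_bind₁ h.noCommonFactor h.isFormMap
      exact ⟨j, fun hA => hj (hZ j ▸ hA.mul_left _)⟩
    · exact hB.exists_not_dvd
  exact ⟨Z, ⟨hΨ, hncf, ⟨_, h0, hZ⟩, hor⟩, hZ⟩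

theorem ContractsToIndeterminacy.exists_liftings [k.AtLeastTwo]
    (h : ContractsToIndeterminacy F P v) :
    ∃ (H : Poly k) (Φ : ℕ → PolyMap k), IsForm H ∧ H ≠ 0 ∧
      (∀ n, IsConsecutive F v n (Φ n) (Φ (n + 1))) ∧
      ∀ n i, bind₁ (Φ (n + 1)) (F i) = bind₁ (Φ n) H * Φ (n + 2) i := by
  have : NeZero k := .of_gt Nat.AtLeastTwo.one_lt
  obtain ⟨H, hH, hH0, hsucc⟩ := h.exists_forall_isConsecutive_succ
  choose! next hnext hmul using hsucc
  let s (n : ℕ) : PolyMap k × PolyMap k := Nat.rec (X, F) (fun n q => (q.2, next n q.1 q.2)) n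
  have hs (n) : IsConsecutive F v n (s n).1 (s n).2 := by
    induction n with
    | zero => exact h.isConsecutive_zero
    | succ n ih => exact hnext n _ _ ih
  exact ⟨H, fun n => (s n).1, hH, hH0, hs, fun n => hmul n _ _ (hs n)⟩

end Consecutive

section QuasiAlgebraicStability

theorem exists_seq_mul_pow_eq {K : Type*} [Field K] {a b u : K} (ha : a ≠ 0) (hb : b ≠ 0)
    (hu : u ≠ 0) (d e : ℕ) : ∃ r : ℕ → K, r 0 = a ∧ r 1 = b ∧ (∀ n, r n ≠ 0) ∧
      ∀ n, r (n + 2) * r n ^ e = u * r (n + 1) ^ d := by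
  let s (n : ℕ) : K × K := Nat.rec (a, b) (fun _ q => (q.2, u * q.2 ^ d / q.1 ^ e)) n
  have hs (n) : (s n).1 ≠ 0 ∧ (s n).2 ≠ 0 := by
    induction n with
    | zero => exact ⟨ha, hb⟩
    | succ n ih =>
      exact ⟨ih.2, div_ne_zero (mul_ne_zero hu (pow_ne_zero d ih.2)) (pow_ne_zero e ih.1)⟩
  exact ⟨fun n => (s n).1, rfl, rfl, fun n => (hs n).1,
    fun n => div_mul_cancel₀ _ (pow_ne_zero e (hs n).1)⟩

/-- Rescaling the initial liftings rescales all further ones. -/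
theorem isQAS_of_forall_bind₁_eq_mul {k : ℕ} {F : PolyMap k} {H : Poly k} {Φ : ℕ → PolyMap k}
    (hF : IsFormMap F) (hncf : NoCommonFactor F) (hH : IsForm H) (h0 : H ≠ 0)
    (hΦ : ∀ n, IsIterateLifting F n (Φ n))
    (hmul : ∀ n i, bind₁ (Φ (n + 1)) (F i) = bind₁ (Φ n) H * Φ (n + 2) i) : IsQAS F := by
  obtain ⟨d, hd⟩ := hF
  obtain ⟨e, he⟩ := hH
  refine ⟨1, H, e, le_rfl, h0, he, fun Ψ hΨ => ?_⟩
  obtain ⟨a, ha, haΨ⟩ := (hΦ 0).eq_C_mul (hΨ 0 zero_le_one)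
  obtain ⟨b, hb, hbΨ⟩ := (hΦ 1).eq_C_mul (hΨ 1 le_rfl)
  obtain ⟨u, hu, huΨ⟩ := (isIterateLifting_one hncf).eq_C_mul (hΨ 1 le_rfl)
  obtain ⟨r, hr0, hr1, hr, hrec⟩ := exists_seq_mul_pow_eq ha hb hu d e
  refine ⟨fun n i => C (r n) * Φ n i, fun n hn => ?_, fun n => (hΦ n).C_mul (hr n),
    fun n hn i => ?_⟩
  · interval_cases n
    · exact _root_.funext fun i => by rw [haΨ, ← hr0]
    · exact _root_.funext fun i => by rw [hbΨ, ← hr1]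
  · obtain ⟨m, rfl⟩ := Nat.exists_eq_add_of_le' hn
    change C (r (m + 2)) * Φ (m + 2) i * bind₁ (fun j => C (r m) * Φ m j) H =
      bind₁ (fun j => C (r (m + 1)) * Φ (m + 1) j) (C (r 1) * Φ 1 i)
    rw [hr1, ← hbΨ, huΨ, map_mul, bind₁_C_right, bind₁_mul_of_isHomogeneous (hd i),
      bind₁_mul_of_isHomogeneous he, hmul, ← C_pow, ← C_pow]
    have hC : (C (r (m + 2)) * C (r m ^ e) : Poly k) = C u * C (r (m + 1) ^ d) := by
      rw [← C_mul, ← C_mul, hrec]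
    linear_combination (bind₁ (Φ m) H * Φ (m + 2) i) * hC

theorem ContractsToIndeterminacy.isQAS {k : ℕ} [k.AtLeastTwo] {F : PolyMap k} {P : Poly k}
    {v : Fin (k + 1) → ℂ} (h : ContractsToIndeterminacy F P v) : IsQAS F := by
  obtain ⟨H, Φ, hH, h0, hΦ, hmul⟩ := h.exists_liftings
  exact isQAS_of_forall_bind₁_eq_mul h.isFormMap h.noCommonFactor hH h0
    (fun n => (hΦ n).isIterateLifting) hmul

end QuasiAlgebraicStability

section Criterion

variable {k n : ℕ} {F : PolyMap k} {P G : Poly k} {V : Set (PSpace k)} {v : Fin (k + 1) → ℂ}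

theorem zeroLocus_subset_of_forall_dvd (hG : IsForm G) (h0 : G ≠ 0)
    (h : ∀ A, IsIrreducibleForm A → A ∣ G → zeroLocus A ⊆ V) : zeroLocus G ⊆ V := by
  intro p hp
  obtain ⟨A, hA, hAp, hAG⟩ := exists_isIrreducibleForm_eval_eq_zero_dvd hG h0 hp
  exact h A hA hAG hAp

theorem mem_indeterminacy_iff {p : PSpace k} :
    p ∈ indeterminacy F ↔ ∀ i, p ∈ zeroLocus (F i) := funext_iff

theorem IsIrreducibleForm.not_subset_indeterminacy [NeZero k] (hG : IsIrreducibleForm G)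
    (hF : IsFormMap F) (hncf : NoCommonFactor F) : ¬ zeroLocus G ⊆ indeterminacy F := by
  intro h
  obtain ⟨i, hi⟩ := hncf.exists_not_dvd hG.irreducible.not_isUnit
  exact hi ((hG.zeroLocus_subset_zeroLocus_iff (hF.isForm i)).mp
    fun p hp => mem_indeterminacy_iff.mp (h hp) i)

namespace ContractsToIndeterminacy

theorem isForm (h : ContractsToIndeterminacy F P v) : IsForm P :=
  have ⟨p, _, hP⟩ := h.isHomogeneous
  ⟨p, hP⟩

theorem isHypersurface (h : ContractsToIndeterminacy F P v) : IsHypersurface (zeroLocus P) :=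
  have ⟨p, hp, hP⟩ := h.isHomogeneous
  ⟨P, p, hp, hP, h.ne_zero, rfl⟩

theorem mk_mem_indeterminacy (h : ContractsToIndeterminacy F P v) :
    Projectivization.mk ℂ v h.vector_ne_zero ∈ indeterminacy F :=
  mem_indeterminacy_iff.mpr fun i =>
    ((h.isFormMap.isForm i).mk_mem_zeroLocus_iff _).mpr (congrFun h.evalMap_eq_zero i)

theorem mk_notMem_zeroLocus (h : ContractsToIndeterminacy F P v) :
    Projectivization.mk ℂ v h.vector_ne_zero ∉ zeroLocus P := by
  rw [h.isForm.mk_mem_zeroLocus_iff]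
  exact h.eval_ne_zero

theorem iterImage_one (h : ContractsToIndeterminacy F P v) : iterImage F 1 V = image F V :=
  (isIterateLifting_one h.noCommonFactor).iterImage_eq

theorem iterImage_one_component [NeZero k] (h : ContractsToIndeterminacy F P v)
    (hG : IsIrreducibleForm G) (hGP : G ∣ P) :
    iterImage F 1 (zeroLocus G) = {Projectivization.mk ℂ v h.vector_ne_zero} := by
  rw [h.iterImage_one]
  exact (h.constMod G hG hGP).image_eq hG h.isFormMap h.vector_ne_zero
    (h.noCommonFactor.exists_not_dvd hG.irreducible.not_isUnit)

theorem iterImage_one_subset [NeZero k] (h : ContractsToIndeterminacy F P v) :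
    iterImage F 1 (zeroLocus P) ⊆ {Projectivization.mk ℂ v h.vector_ne_zero} := by
  rw [h.iterImage_one]
  refine fun p hp => eq_mk_of_forall_mem_zeroLocus h.vector_ne_zero fun i j => ?_
  have hform : IsForm (C (v i) * X j - C (v j) * X i) := isForm_C_mul_X_sub ..
  refine (image_subset_zeroLocus_iff_forall_mul hform).mpr (fun l => ?_) hp
  refine zeroLocus_subset_of_forall_dvd h.isForm h.ne_zero fun A hA hAP => ?_
  refine (image_subset_zeroLocus_iff_forall_mul hform).mp ?_ l
  rw [← h.iterImage_one, h.iterImage_one_component hA hAP, Set.singleton_subset_iff,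
    hform.mk_mem_zeroLocus_iff]
  simp [mul_comm]

theorem isDegreeLowering_one [NeZero k] (h : ContractsToIndeterminacy F P v)
    (hV : IsHypersurface V) (hVP : V ⊆ zeroLocus P) : IsDegreeLowering F V 1 := by
  refine ⟨hV, le_rfl, fun p hp => ?_, fun m hm hm1 => absurd hm hm1.not_ge⟩
  rw [h.iterImage_one] at hp
  have := h.iterImage_one_subset (h.iterImage_one ▸ image_mono hVP hp)
  exact this ▸ h.mk_mem_indeterminacy

theorem codimGtOne_iterImage_one [k.AtLeastTwo] (h : ContractsToIndeterminacy F P v) :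
    CodimGtOne (iterImage F 1 (zeroLocus P)) := by
  have : NeZero k := .of_gt Nat.AtLeastTwo.one_lt
  intro W hW hsub
  obtain ⟨A, hA, rfl⟩ := isIrreducibleHypersurface_iff.mp hW
  exact hA.isHypersurface.not_subset_singleton _ (hsub.trans h.iterImage_one_subset)

theorem exists_iterImage_eq_component [k.AtLeastTwo] (h : ContractsToIndeterminacy F P v)
    (hV : IsIrreducibleHypersurface V) (hn : IsDegreeLowering F V n) :
    ∃ m < n, ∃ B, IsIrreducibleForm B ∧ B ∣ P ∧ iterImage F m V = zeroLocus B := by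
  have : NeZero k := .of_gt Nat.AtLeastTwo.one_lt
  obtain ⟨A, hA, rfl⟩ := isIrreducibleHypersurface_iff.mp hV
  obtain ⟨H, Φ, -, -, hΦ, -⟩ := h.exists_liftings
  obtain ⟨-, hn1, hind, -⟩ := hn
  obtain ⟨m, rfl⟩ := Nat.exists_eq_add_of_le' hn1
  have hform (l) : IsFormMap (Φ l) := (hΦ l).isIterateLifting.isFormMap h.isFormMap
  have hcontracted (B : Poly k) : ¬ MapsOnto (Φ (m + 1)) A B := fun hB => by
    rw [(hΦ (m + 1)).isIterateLifting.iterImage_eq, hB.image_eq hA (hform _)] at hind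
    exact hB.isIrreducibleForm.not_subset_indeterminacy h.isFormMap h.noCommonFactor hind
  obtain ⟨B, hB⟩ := ((hΦ m).mapsOnto_or A hA).resolve_right fun ⟨_, B, hB⟩ => hcontracted B hB
  refine ⟨m, m.lt_succ_self, B, hB.isIrreducibleForm, ?_, ?_⟩
  · by_contra hBP
    obtain ⟨D, hD⟩ := h.exists_mapsOnto B hB.isIrreducibleForm hBP
    obtain ⟨c, -, hmul⟩ := (hΦ m).exists_eq_mul
    have hmaps := hB.comp hD h.isFormMap
    rw [_root_.funext hmul] at hmaps
    exact hcontracted D (hmaps.of_mul hA.irreducible.prime)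
  · rw [(hΦ m).isIterateLifting.iterImage_eq, hB.image_eq hA (hform m)]

theorem isPrimitiveSystem_singleton [k.AtLeastTwo] (h : ContractsToIndeterminacy F P v) :
    IsPrimitiveSystem F {(zeroLocus P, 1)} where
  finite := Set.finite_singleton _
  degreeLowering := by
    have : NeZero k := .of_gt Nat.AtLeastTwo.one_lt
    rintro _ rfl
    exact h.isDegreeLowering_one h.isHypersurface subset_rfl
  heights_ne := by
    rintro _ rfl _ rfl hne
    exact absurd rfl hne
  codim := by
    rintro _ rfl m hm hm1
    obtain rfl := hm.antisymm hm1
    exact h.codimGtOne_iterImage_one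
  captures V n hV hn := by
    obtain ⟨m, hm, B, hB, hBP, himage⟩ := h.exists_iterImage_eq_component hV hn
    exact ⟨m, hm, _, rfl, himage ▸ hB.isHypersurface,
      himage ▸ zeroLocus_subset_zeroLocus_of_dvd hBP⟩

theorem subset_zeroLocus_of_codimGtOne [NeZero k] (h : ContractsToIndeterminacy F P v)
    (hV : IsHypersurface V) (hcodim : CodimGtOne (iterImage F 1 V)) : V ⊆ zeroLocus P := by
  obtain ⟨G, e, -, hG, h0, rfl⟩ := hV
  refine zeroLocus_subset_of_forall_dvd ⟨e, hG⟩ h0 fun A hA hAG => ?_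
  refine zeroLocus_subset_zeroLocus_of_dvd ?_
  by_contra hAP
  obtain ⟨B, hB⟩ := h.exists_mapsOnto A hA hAP
  refine hcodim _ hB.isIrreducibleForm.isIrreducibleHypersurface ?_
  rw [h.iterImage_one, ← hB.image_eq hA h.isFormMap]
  exact image_mono (zeroLocus_subset_zeroLocus_of_dvd hAG)

theorem eq_singleton_of_isPrimitiveSystem [NeZero k] (h : ContractsToIndeterminacy F P v)
    {S : Set (Set (PSpace k) × ℕ)} (hS : IsPrimitiveSystem F S) : S = {(zeroLocus P, 1)} := by
  have hsubset (s) (hs : s ∈ S) : s.1 ⊆ zeroLocus P :=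
    h.subset_zeroLocus_of_codimGtOne (hS.degreeLowering s hs).1
      (hS.codim s hs 1 le_rfl (hS.degreeLowering s hs).2.1)
  have hheight (s) (hs : s ∈ S) : s.2 = 1 := by
    obtain ⟨hhyp, hpos, -, hmin⟩ := hS.degreeLowering s hs
    by_contra hne
    exact hmin 1 le_rfl (hpos.lt_of_ne' hne) (h.isDegreeLowering_one hhyp (hsubset s hs)).2.2.1
  have heq (s) (hs : s ∈ S) (t) (ht : t ∈ S) : s = t := by
    by_contra hne
    exact hS.heights_ne s hs t ht hne ((hheight s hs).trans (hheight t ht).symm)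
  have hcaptured (A : Poly k) (hA : IsIrreducibleForm A) (hAP : zeroLocus A ⊆ zeroLocus P) :
      ∃ s ∈ S, zeroLocus A ⊆ s.1 := by
    obtain ⟨m, hm, s, hs, -, hsub⟩ := hS.captures _ 1 hA.isIrreducibleHypersurface
      (h.isDegreeLowering_one hA.isHypersurface hAP)
    rw [Nat.lt_one_iff.mp hm, iterImage_zero hA] at hsub
    exact ⟨s, hs, hsub⟩
  obtain ⟨A, hA, hAP⟩ := h.isHypersurface.exists_isIrreducibleForm
  obtain ⟨s, hs, -⟩ := hcaptured A hA hAP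
  have hsP : zeroLocus P ⊆ s.1 := zeroLocus_subset_of_forall_dvd h.isForm h.ne_zero fun B hB hBP =>
    have ⟨t, ht, hBt⟩ := hcaptured B hB (zeroLocus_subset_zeroLocus_of_dvd hBP)
    heq t ht s hs ▸ hBt
  have hsPair : s = (zeroLocus P, 1) := Prod.ext ((hsubset s hs).antisymm hsP) (hheight s hs)
  exact hsPair ▸ Set.eq_singleton_iff_unique_mem.mpr ⟨hs, fun t ht => heq t ht s hs⟩

theorem isHypersurface_iterImage_two [k.AtLeastTwo] (h : ContractsToIndeterminacy F P v)
    (hG : IsIrreducibleForm G) (hGP : G ∣ P) : IsHypersurface (iterImage F 2 (zeroLocus G)) := by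
  have : NeZero k := .of_gt Nat.AtLeastTwo.one_lt
  obtain ⟨H, Φ, -, -, -, hΦ, -⟩ := h.exists_second_lifting
  obtain ⟨B, hB⟩ := h.exists_mapsOnto_second Φ hΦ G hG hGP
  rw [hΦ.iterImage_eq, hB.image_eq hG (hΦ.isFormMap h.isFormMap)]
  exact hB.isIrreducibleForm.isHypersurface

theorem satisfiesCriterion [k.AtLeastTwo] (h : ContractsToIndeterminacy F P v) :
    SatisfiesCriterion F (zeroLocus P) 1 := by
  have : NeZero k := .of_gt Nat.AtLeastTwo.one_lt
  refine ⟨fun S => ⟨h.eq_singleton_of_isPrimitiveSystem, ?_⟩, ?_, ?_⟩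
  · rintro rfl
    exact h.isPrimitiveSystem_singleton
  · intro V hV hVP m hm hm1
    obtain rfl := hm.antisymm hm1
    obtain ⟨A, hA, rfl⟩ := isIrreducibleHypersurface_iff.mp hV
    have hAP : A ∣ P := (hA.zeroLocus_subset_zeroLocus_iff h.isForm).mp hVP
    rw [h.iterImage_one_component hA hAP, Set.singleton_subset_iff]
    exact h.mk_notMem_zeroLocus
  · intro V hV hVP
    obtain ⟨A, hA, rfl⟩ := isIrreducibleHypersurface_iff.mp hV
    have hAP : A ∣ P := (hA.zeroLocus_subset_zeroLocus_iff h.isForm).mp hVP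
    exact .inr ⟨1, le_rfl, h.isHypersurface_iterImage_two hA hAP,
      fun m hm hm1 => absurd (hm.trans hm1) (by decide)⟩

end ContractsToIndeterminacy
end Criterion

section Family

variable {p q : ℕ} {P R A : Poly 2} {Q : Fin 3 → Poly 2}

theorem isFormMap_familyMap (hP : P.IsHomogeneous p) (hQ : ∀ j, (Q j).IsHomogeneous q)
    (hR : R.IsHomogeneous (p + q)) : IsFormMap (familyMap P R Q) :=
  ⟨p + q, fun j => (hP.mul (hQ j)).sub hR⟩

theorem sum_C_mul_familyMap {a : Fin 3 → ℂ} (ha : ∑ j, a j = 0) :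
    ∑ j, C (a j) * familyMap P R Q j = P * ∑ j, C (a j) * Q j := by
  have hR : ∑ j, C (a j) * R = 0 := by rw [← Finset.sum_mul, ← map_sum, ha, C_0, zero_mul]
  simp only [familyMap, mul_sub, Finset.sum_sub_distrib, hR, sub_zero, Finset.mul_sum,
    mul_left_comm]

theorem constMod_familyMap_of_dvd (hAP : A ∣ P) : ConstMod A (familyMap P R Q) fun _ => 1 := by
  intro i j
  rw [← mul_sub, show familyMap P R Q j - familyMap P R Q i = P * (Q j - Q i) by
    simp only [familyMap]; ring]
  exact (hAP.mul_right _).mul_left _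

/-- If `F` were constant with value `v` on `{A = 0}`, a line `{∑ a_j x_j = 0}` through `[1 : 1 : 1]`
and `v` would give `A ∣ ∑ a_j F_j = P * ∑ a_j Q_j`. -/
theorem nonConstMod_familyMap_of_not_dvd (hF : IsFormMap (familyMap P R Q))
    (hcop : NoCommonFactor (familyMap P R Q))
    (hpencil : ∀ a : Fin 3 → ℂ, a ≠ 0 → ∑ j, a j = 0 → ∀ V, IsIrreducibleHypersurface V →
      V ⊆ zeroLocus (∑ j, C (a j) * Q j) → IsHypersurface (image (familyMap P R Q) V))
    (hA : IsIrreducibleForm A) (hAP : ¬ A ∣ P) : NonConstMod A (familyMap P R Q) := by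
  intro v hv hconst
  obtain ⟨i, hi⟩ := hcop.exists_not_dvd hA.irreducible.not_isUnit
  obtain ⟨a, ha, ha1, hav⟩ := exists_ne_zero_dotProduct_eq_zero (by simp) 1 v
  rw [dotProduct_one] at ha1
  have hdvd : A ∣ ∑ j, C (a j) * familyMap P R Q j := by
    simpa using (hconst.dvd_bind₁_iff hA.irreducible.prime hv ⟨i, hi⟩
      (isIrreducibleForm_sum_C_mul_X ha).isForm).mpr (by simpa [dotProduct] using hav)
  rw [sum_C_mul_familyMap ha1] at hdvd
  have hAQ := (hA.irreducible.prime.dvd_or_dvd hdvd).resolve_left hAP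
  exact nonConstMod_of_isHypersurface_image hA hF ⟨i, hi⟩ (hpencil a ha ha1 _
    hA.isIrreducibleHypersurface (zeroLocus_subset_zeroLocus_of_dvd hAQ)) v hv hconst

theorem IsIterateLifting.exists_mapsOnto {F Φ : PolyMap 2} {n : ℕ} (h : IsIterateLifting F n Φ)
    (hF : IsFormMap F) (hA : IsIrreducibleForm A)
    (himage : IsHypersurface (iterImage F n (zeroLocus A))) : ∃ B, MapsOnto Φ A B :=
  (nonConstMod_of_isHypersurface_image hA (h.isFormMap hF)
    (h.1.exists_not_dvd hA.irreducible.not_isUnit) (h.iterImage_eq ▸ himage)).exists_mapsOnto hA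
    (h.isFormMap hF)

end Family

end QASMap

theorem mainTheorem2
    (p q : ℕ) (P R : QASMap.Poly 2) (Q : Fin 3 → QASMap.Poly 2)
    (hp : 0 < p) (hP : P.IsHomogeneous p) (hQ : ∀ j, (Q j).IsHomogeneous q)
    (hR : R.IsHomogeneous (p + q))
    (hone : ∀ j, MvPolynomial.eval (fun _ => (1 : ℂ)) P * MvPolynomial.eval (fun _ => (1 : ℂ)) (Q j)
      = MvPolynomial.eval (fun _ => (1 : ℂ)) R)
    (hR1 : MvPolynomial.eval (fun _ => (1 : ℂ)) R ≠ 0)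
    (hcop : QASMap.NoCommonFactor (QASMap.familyMap P R Q))
    (h1 : ∀ a : Fin 3 → ℂ, a ≠ 0 → ∑ j, a j = 0 →
      ∀ V, QASMap.IsIrreducibleHypersurface V →
        V ⊆ QASMap.zeroLocus (∑ j, MvPolynomial.C (a j) * Q j) →
          QASMap.IsHypersurface (QASMap.image (QASMap.familyMap P R Q) V))
    (h2 : ∀ V, QASMap.IsIrreducibleHypersurface V → V ⊆ QASMap.zeroLocus P →
      QASMap.IsHypersurface (QASMap.iterImage (QASMap.familyMap P R Q) 2 V))
    (h3 : ∀ V, QASMap.IsIrreducibleHypersurface V →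
      QASMap.image (QASMap.familyMap P R Q) V = {QASMap.onePoint} → V ⊆ QASMap.zeroLocus P) :
    QASMap.IsDominantSelfMap (QASMap.familyMap P R Q) ∧
    QASMap.SatisfiesCriterion (QASMap.familyMap P R Q) (QASMap.zeroLocus P) 1 ∧
    QASMap.IsQAS (QASMap.familyMap P R Q) := by
  have hF := QASMap.isFormMap_familyMap hP hQ hR
  have h : QASMap.ContractsToIndeterminacy (QASMap.familyMap P R Q) P (fun _ => 1) :=
    { isFormMap := hF
      noCommonFactor := hcop
      isHomogeneous := ⟨p, hp, hP⟩
      eval_ne_zero := fun h0 => hR1 (by rw [← hone 0, h0, zero_mul])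
      evalMap_eq_zero := funext fun j => by
        simp only [QASMap.evalMap, QASMap.familyMap, map_sub, map_mul, hone, sub_self,
          Pi.zero_apply]
      constMod := fun _ _ => QASMap.constMod_familyMap_of_dvd
      exists_mapsOnto := fun _ hA hAP =>
        (QASMap.nonConstMod_familyMap_of_not_dvd hF hcop h1 hA hAP).exists_mapsOnto hA hF
      exists_mapsOnto_second := fun _ hΦ _ hA hAP => hΦ.exists_mapsOnto hF hA
        (h2 _ hA.isIrreducibleHypersurface (QASMap.zeroLocus_subset_zeroLocus_of_dvd hAP)) }
  exact ⟨h.isDominantSelfMap, h.satisfiesCriterion, h.isQAS⟩
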